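/- **Setup.** Let $\mathcal X$ be a nonempty state space (second countable, metrizable, standard Borel) and $\mathcal A$ a measurable action space, $\mathcal P(\cdot\mid x,a)$ a Markov kernel, $\pi_B$ a behavior policy, and $\mathcal P^{\pi_B}(B\mid x)=\int \mathcal P(B\mid x,a)\,\pi_B(da\mid x)$. Let $V(x,g)=\mathbb E[\inf\{t\ge 0: x_t=g\}\mid x_0=x]$ be the expected hitting time of $g$ for the chain with kernel $\mathcal P^{\pi_B}$, and $G(s,u,g)=V(s,g)-V(u,g)$. Fix $x_0\in\mathcal X$, a full-support probability measure $\nu$ on $\mathcal X$, and $\epsilon\ge 0$. **References.** An admissible reference $r\in\mathfrak R_\epsilon$ consists of a real Hilbert space $\widetilde{\mathcal H}$ with a measurable feature map $\widetilde\phi:\mathcal X\to\widetilde{\mathcal H}$ that is integrable under every $\mathcal P^{\pi_B}(\cdot\mid x)$; a finite-dimensional subspace $\mathcal H^r$ with orthogonal projection $P$, giving $\phi^r=P\widetilde\phi$; and, for each goal $g$, a linear operator $\mathcal T_g$ on $\mathcal H^r$ (it may, but need not, depend on $g$), a vector $\omega_g^r$ (measurable in $g$) and a constant $C_H(r,g)\ge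 1$. With $\mathcal H_g=\operatorname{span}\{\phi^r(g)\}$, $\mathcal H_{Q,g}=\mathcal H_g^\perp$ and $\mathcal T_{Q,g}=P_{Q,g}\mathcal T_g|_{\mathcal H_{Q,g}}$, it is required for every $g$ that (a) $\|P\,\mathbb E_{x'\sim\mathcal P^{\pi_B}(\cdot\mid x)}[\widetilde\phi(x')]-\mathcal T_g\phi^r(x)\|\le\epsilon$ for all $x\ne g$; (b) $\mathcal T_g\mathcal H_g\subseteq\mathcal H_g$; (c) $\omega_g^r\in\mathcal H_{Q,g}$ and $(\mathcal T_{Q,g}-I)^*\omega_g^r=\mathbf w_{\mathbf 1}$ for some $\mathbf w_{\mathbf 1}\in\mathcal H_{Q,g}$ with $\langle\phi^r(x),\mathbf w_{\mathbf 1}\rangle=1$ for all $x\ne g$; (d) the spectral radius (of the complexification) satisfies $\rho(\mathcal T_{Q,g})<1$, and on bounded measurable functions on $\mathcal X\setminus\{g\}$ the operator $I-P_Q$, where $(P_Qf)(x)=\mathbb E_{x'\sim\mathcal P^{\pi_B}(\cdot\mid x)}[f(x')\mathbf 1\{x'\ne g\}]$, is invertible with $\|(I-P_Q)^{-1}\|_\infty\le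 C_H(r,g)/(1-\rho(\mathcal T_{Q,g}))$. Moreover $C_H(r)=\sup_gC_H(r,g)$ and $C_\omega(r)=\sup_g\|\omega^r_g\|$ are finite, $\rho_r=\sup_g\rho(\mathcal T_{Q,g})<1$, and the analysis operator $(B_rd)(h)=\langle d,\omega^r_h\rangle$ is bounded and bounded below as a map from $D_r=\overline{\operatorname{span}}\{\phi^r(g)-\phi^r(x_0):g\in\mathcal X\}$ to $L^2(\nu)$. Put $$\eta^\star_\epsilon=\inf_{r\in\mathfrak R_\epsilon}\frac{C_H(r)C_\omega(r)\epsilon}{1-\rho_r}.$$ **Data and learner.** Let $\mathcal H$ be a real Hilbert space, $\bar\omega_\psi:\mathcal X\to\mathcal H$ a fixed measurable task encoder with $\|\bar\omega_\psi(g)\|\le C_{\bar\omega_\psi}$, and $\Phi$ a class of measurable encoders $\phi:\mathcal X\to\mathcal H$ with $\|\phi(x)\|\le C_\phi$; write $f_\phi(s,u,g)=\langle\phi(u)-\phi(s),\bar\omega_\psi(g)\rangle$. Let $\tau^1,\dots,\tau^N$ ($N\ge1$) be i.i.d. finite trajectories generated by $\pi_B$ and $\mathcal P$ from some initial law. A measurable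 rule extracts from each trajectory $\tau$ exactly $m_{\mathrm{tr}}\ge1$ tuples $(s_t(\tau),u_t(\tau),g_t(\tau),H_t(\tau))\in\mathcal X^3\times\mathbb R$, with $0\le H_t\le H_{\max}$ almost surely. Let $\mu$ be the law of $(S,U,\mathsf G,H)$, a uniformly selected extracted tuple of one such trajectory, $\lambda$ its $(S,U)$-marginal, and $m_{\mathrm{traj}}=\mathbb E[H\mid S,U,\mathsf G]$. Let $\widehat\phi_N\in\Phi$ minimize over $\Phi$ $$\widehat R_N(\phi)=\frac1{Nm_{\mathrm{tr}}}\sum_{j=1}^N\sum_{t=1}^{m_{\mathrm{tr}}}\bigl(f_\phi(s_t(\tau^j),u_t(\tau^j),g_t(\tau^j))-H_t(\tau^j)\bigr)^2,$$ and let $D_N=\overline{\operatorname{span}}\{\widehat\phi_N(u)-\widehat\phi_N(s):(s,u)\in\operatorname{supp}\lambda\}$. With independent uniform signs $\sigma_j$, put $$\overline{\mathfrak R}_N=\frac1{m_{\mathrm{tr}}}\sum_{t=1}^{m_{\mathrm{tr}}}\mathbb E_{\tau^{1:N},\sigma}\Bigl[\sup_{\phi\in\Phi}\frac1N\sum_{j=1}^N\sigma_jf_\phi(s_t(\tau^j),u_t(\tau^j),g_t(\tau^j))\Bigr],$$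 $$\Gamma_N(\delta)=16(2C_\phi C_{\bar\omega_\psi}+H_{\max})\overline{\mathfrak R}_N+2(2C_\phi C_{\bar\omega_\psi}+H_{\max})^2\sqrt{\frac{\log(1/\delta)}{2N}}.$$ **Theorem.** Assume: (i) there is $c_{\mathrm{cov}}\in(0,1]$ such that for $\lambda$-a.e. $(s,u)$ the conditional law of $\mathsf G$ given $S=s,U=u$ is at least $c_{\mathrm{cov}}\,\nu$ on all measurable sets; (ii) almost surely the analysis operator $(A_Nd)(g)=\langle d,\bar\omega_\psi(g)\rangle$ is bounded as a map $D_N\to L^2(\nu)$; (iii) $\inf_{\phi\in\Phi}\|f_\phi-G\|_{L^2(\mu)}\le2\eta^\star_\epsilon+\eta_{\mathrm{cls}}$; (iv) $\|m_{\mathrm{traj}}-G\|_{L^2(\mu)}\le\eta_{\mathrm{traj}}$. Let $\delta\in(0,1)$, $\delta_{\mathrm{or}}>0$, let $r\in\mathfrak R_\epsilon$ satisfy $C_H(r)C_\omega(r)\epsilon/(1-\rho_r)\le\eta^\star_\epsilon+\delta_{\mathrm{or}}$, and let $m_B>0$ satisfy $\|B_rd\|_{L^2(\nu)}\ge m_B\|d\|$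 for all $d\in D_r$. Then, with probability at least $1-\delta$ over $\tau^1,\dots,\tau^N$, there is a bounded linear map $T:D_N\to D_r$ (depending on the data) with $$\int\bigl\|T(\widehat\phi_N(u)-\widehat\phi_N(s))-(\phi^r(u)-\phi^r(s))\bigr\|^2d\lambda(s,u)\le\frac4{c_{\mathrm{cov}}m_B^2}\Bigl[(2\eta^\star_\epsilon+\eta_{\mathrm{cls}}+\eta_{\mathrm{traj}})^2+\Gamma_N(\delta)+\eta_{\mathrm{traj}}^2+2(\eta^\star_\epsilon+\delta_{\mathrm{or}})^2\Bigr].$$ -/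

import Mathlib

open MeasureTheory ProbabilityTheory
open scoped ENNReal InnerProductSpace TensorProduct

universe u v w w₁ w₂

noncomputable section

namespace HittingGeometry

/-! ### Controlled Markov processes, path laws, expected hitting times -/

section Dynamics

variable {S : Type u} [MeasurableSpace S]

/-- Law of the time-homogeneous Markov chain `(Y₀, Y₁, …)` with initial law `ρ` and one-step
transition kernel `κ`. -/
def chainLaw (ρ : Measure S) (κ : Kernel S S) [IsMarkovKernel κ] : Measure (ℕ → S) :=
  Kernel.trajMeasure (X := fun _ => S) ρ
    (fun n => κ.comap (fun h : (Π _ : Finset.Iic n, S) => h ⟨n, Finset.mem_Iic.2 le_rfl⟩)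
      (measurable_pi_apply _))

/-- `inf {t ≥ 0 : y_t = g}`, with value `∞` when `g` is never visited. -/
def hittingTime (g : S) (y : ℕ → S) : ℝ≥0∞ :=
  ⨅ t : ℕ, ⨅ _ : y t = g, (t : ℝ≥0∞)

variable {X : Type u} [MeasurableSpace X] {A : Type v} [MeasurableSpace A]

/-- The policy-induced state kernel `P^π(B | x) = ∫ P(B | x, a) π(da | x)`. -/
def policyKernel (P : Kernel (X × A) X) (π : Kernel X A) : Kernel X X :=
  P ∘ₖ (Kernel.id ×ₖ π)

instance (P : Kernel (X × A) X) [IsMarkovKernel P] (π : Kernel X A) [IsMarkovKernel π] :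
    IsMarkovKernel (policyKernel P π) := by
  unfold policyKernel; infer_instance

/-- The state-action kernel: from `(x, a)` draw `x' ∼ P(· | x, a)` and then `a' ∼ π(· | x')`. -/
def stateActionKernel (P : Kernel (X × A) X) (π : Kernel X A) : Kernel (X × A) (X × A) :=
  (Kernel.id ×ₖ π) ∘ₖ P

instance (P : Kernel (X × A) X) [IsMarkovKernel P] (π : Kernel X A) [IsMarkovKernel π] :
    IsMarkovKernel (stateActionKernel P π) := by
  unfold stateActionKernel; infer_instance

/-- Expected hitting time `V^π(x, g) = E[inf {t ≥ 0 : x_t = g} | x_0 = x]`, possibly `∞`. -/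
def expectedHittingTime (P : Kernel (X × A) X) [IsMarkovKernel P]
    (π : Kernel X A) [IsMarkovKernel π] (x g : X) : ℝ≥0∞ :=
  ∫⁻ y, hittingTime g y ∂(chainLaw (Measure.dirac x) (policyKernel P π))

/-- The ideal displacement target `G^π(s, u, g) = V^π(s, g) - V^π(u, g)`. -/
def displacementTarget (P : Kernel (X × A) X) [IsMarkovKernel P]
    (π : Kernel X A) [IsMarkovKernel π] (s u g : X) : ℝ :=
  (expectedHittingTime P π s g).toReal - (expectedHittingTime P π u g).toReal

variable (X A) in
/-- Finite trajectories `(x_0, a_0, x_1, a_1, …, x_n)` of arbitrary length `n`. -/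
abbrev Trajectory : Type (max u v) := Σ n : ℕ, (Fin (n + 1) → X) × (Fin n → A)

/-- Record the first `n` steps of an infinite state-action path. -/
def truncatePath (q : (ℕ → X × A) × ℕ) : Trajectory X A :=
  ⟨q.2, fun i => (q.1 i).1, fun i => (q.1 i).2⟩

/-- `Q` is a law of finite trajectories generated by the interaction of the policy `π` with `P`
from the initial law `ρ₀`; the length of the recorded trajectory is allowed to be random. -/
def IsTrajectoryLaw (P : Kernel (X × A) X) [IsMarkovKernel P]
    (π : Kernel X A) [IsMarkovKernel π] (ρ₀ : Measure X) (Q : Measure (Trajectory X A)) : Prop :=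
  ∃ J : Measure ((ℕ → X × A) × ℕ),
    J.map Prod.fst = chainLaw (ρ₀ ⊗ₘ π) (stateActionKernel P π) ∧ Q = J.map truncatePath

/-! ### The transition operator killed at the goal -/

/-- `(P_Q f)(x) = E_{x' ∼ κ(x)} [f(x') 1{x' ≠ g}]` on functions of the transient states. -/
def killedOperator (κ : Kernel X X) (g : X) (f : {x : X // x ≠ g} → ℝ) :
    {x : X // x ≠ g} → ℝ :=
  fun x => ∫ x', Function.extend Subtype.val f 0 x' ∂(κ x)

/-- The bounded measurable functions on the transient states. -/
def boundedMeasurable (g : X) : Set ({x : X // x ≠ g} → ℝ) :=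
  {f | Measurable f ∧ ∃ M : ℝ, ∀ x, |f x| ≤ M}

/-- `I - P_Q` is invertible on the bounded measurable functions on the transient states, and
`‖(I - P_Q)⁻¹‖_∞ ≤ K` for the operator norm induced by the supremum norm. -/
def ResolventBound (κ : Kernel X X) (g : X) (K : ℝ) : Prop :=
  Set.BijOn (fun f => f - killedOperator κ g f) (boundedMeasurable g) (boundedMeasurable g) ∧
  ∀ f ∈ boundedMeasurable g, ∀ M : ℝ,
    (∀ x, |(f - killedOperator κ g f) x| ≤ M) → ∀ x, |f x| ≤ K * M

end Dynamics

/-! ### Operators on Hilbert spaces -/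

section Operators

variable {E : Type w} [NormedAddCommGroup E] [InnerProductSpace ℝ E]

/-- The compression `P_K T |_K` of `T` to the subspace `K`. -/
def compression (K : Submodule ℝ E) [K.HasOrthogonalProjection] (T : E →L[ℝ] E) : K →L[ℝ] K :=
  K.orthogonalProjectionOnto ∘L T ∘L K.subtypeL

/-- `sup {|z| : z ∈ σ(T)}`, where `σ(T) ⊆ ℂ` is the spectrum of the complexification of the real
operator `T` (the value is `0` on the zero space). -/
def complexSpectralRadius (T : E →L[ℝ] E) : ℝ :=
  sSup (norm '' spectrum ℂ
    (LinearMap.baseChange ℂ (T : E →ₗ[ℝ] E) : Module.End ℂ (ℂ ⊗[ℝ] E)))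

variable {X : Type u} [MeasurableSpace X]

/-- The analysis operator `d ↦ (h ↦ ⟨d, ω_h⟩)` is a bounded map `D → L²(ν)`. -/
def AnalysisBounded (ν : Measure X) (D : Submodule ℝ E) (ω : X → E) : Prop :=
  ∃ C : ℝ, ∀ d ∈ D, MemLp (fun h => ⟪d, ω h⟫_ℝ) 2 ν ∧
    eLpNorm (fun h => ⟪d, ω h⟫_ℝ) 2 ν ≤ ENNReal.ofReal (C * ‖d‖)

/-- `m` is a lower-bound constant of the analysis operator `d ↦ (h ↦ ⟨d, ω_h⟩)` on `D`. -/
def AnalysisLowerBound (ν : Measure X) (D : Submodule ℝ E) (ω : X → E) (m : ℝ) : Prop :=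
  ∀ d ∈ D, ENNReal.ofReal (m * ‖d‖) ≤ eLpNorm (fun h => ⟪d, ω h⟫_ℝ) 2 ν

end Operators

/-! ### Reference representations -/

/-- The data of a reference: a finite-dimensional subspace `H` of an ambient Hilbert space, an
ambient feature map, a latent transition operator on `H` for every goal (for a fixed goal `g`,
the process is run until it reaches `g`, so the operator may depend on `g`), the vectors `ω_g`,
and the constants `C_H(g)` of the resolvent bounds. -/
structure Reference (X : Type u) where
  Ambient : Type w
  [normed : NormedAddCommGroup Ambient]
  [inner : InnerProductSpace ℝ Ambient]
  [complete : CompleteSpace Ambient]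
  H : Submodule ℝ Ambient
  [finiteDim : FiniteDimensional ℝ H]
  ambientFeature : X → Ambient
  T : X → (H →L[ℝ] H)
  ω : X → H
  CH : X → ℝ

attribute [instance] Reference.normed Reference.inner Reference.complete Reference.finiteDim

namespace Reference

variable {X : Type u} (r : Reference.{u, w} X)

/-- The compressed encoder `φ(x) = P_d φ̃(x)`. -/
def φ (x : X) : r.H := r.H.orthogonalProjectionOnto (r.ambientFeature x)

/-- The goal subspace `H_g = span {φ(g)}`. -/
def goalSpace (g : X) : Submodule ℝ r.H := Submodule.span ℝ {r.φ g}

/-- The transient subspace `H_Q = H_g^⊥`. -/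
def transientSpace (g : X) : Submodule ℝ r.H := (r.goalSpace g)ᗮ

instance (g : X) : CompleteSpace (r.transientSpace g) := by
  unfold transientSpace; infer_instance

/-- The compressed transient latent operator `T_Q = P_Q T |_{H_Q}`. -/
def transientOperator (g : X) : r.transientSpace g →L[ℝ] r.transientSpace g :=
  compression (r.transientSpace g) (r.T g)

/-- `ρ(T_Q)` for the goal `g`. -/
def ρ (g : X) : ℝ := complexSpectralRadius (E := r.transientSpace g) (r.transientOperator g)

/-- The displacement space `D_r = closure of span {φ(g) - φ(x₀)}`. -/
def displacementSpace (x₀ : X) : Submodule ℝ r.H :=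
  (Submodule.span ℝ (Set.range fun g => r.φ g - r.φ x₀)).topologicalClosure

/-- `C_H(r) C_ω(r) ε / (1 - ρ_r)`, with the three constants the suprema over all goals. -/
def benchmark (ε : ℝ) : ℝ :=
  (⨆ g, r.CH g) * (⨆ g, ‖r.ω g‖) * ε / (1 - ⨆ g, r.ρ g)

variable [MeasurableSpace X]

/-- Admissibility for one goal `g`: `ε`-sufficient capacity at the states from which the chain
stopped at `g` still moves, a representer `w₁ ∈ H_Q` of the transient unit cost, invariance of the
goal subspace, the adjoint equation `(T_Q - I)* ω_g = w₁` in `H_Q`, and the resolvent bound. -/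
structure AdmissibleAt (κ : Kernel X X) (ε : ℝ) (g : X) : Prop where
  capacity : ∀ x, x ≠ g →
    ‖r.H.orthogonalProjectionOnto (∫ x', r.ambientFeature x' ∂(κ x)) - r.T g (r.φ x)‖ ≤ ε
  invariant : ∀ v ∈ r.goalSpace g, r.T g v ∈ r.goalSpace g
  adjoint_eq : ∃ w₁ ω' : r.transientSpace g,
    (∀ x, x ≠ g → ⟪r.φ x, (w₁ : r.H)⟫_ℝ = 1) ∧ (ω' : r.H) = r.ω g ∧
    ContinuousLinearMap.adjoint (𝕜 := ℝ) (E := r.transientSpace g) (F := r.transientSpace g)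
      (r.transientOperator g - ContinuousLinearMap.id ℝ (r.transientSpace g)) ω' = w₁
  one_le_CH : 1 ≤ r.CH g
  ρ_lt_one : r.ρ g < 1
  resolvent : ResolventBound κ g (r.CH g / (1 - r.ρ g))

/-- Membership in the class of admissible references for the state kernel `κ`, the accuracy `ε`,
the base point `x₀` and the measure `ν`: admissibility for every goal, finite suprema of the
constants, and an analysis operator `D_r → L²(ν)` that is bounded and bounded below. -/
structure Admissible (κ : Kernel X X) (ε : ℝ) (x₀ : X) (ν : Measure X) : Prop where
  stronglyMeasurable_feature : StronglyMeasurable r.ambientFeature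
  stronglyMeasurable_ω : StronglyMeasurable r.ω
  integrable_feature : ∀ x, Integrable r.ambientFeature (κ x)
  at_goal : ∀ g, r.AdmissibleAt κ ε g
  bddAbove_CH : BddAbove (Set.range r.CH)
  bddAbove_ω : BddAbove (Set.range fun g => ‖r.ω g‖)
  bddAbove_ρ : BddAbove (Set.range r.ρ)
  iSup_ρ_lt_one : (⨆ g, r.ρ g) < 1
  analysis_bounded : AnalysisBounded ν (r.displacementSpace x₀) r.ω
  analysis_bounded_below : ∃ m : ℝ, 0 < m ∧ AnalysisLowerBound ν (r.displacementSpace x₀) r.ω m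

end Reference

/-- The benchmark scale `η*_ε`: the infimum of `C_H(r) C_ω(r) ε / (1 - ρ_r)` over the class of
admissible references. -/
def oracleScale {X : Type u} [MeasurableSpace X] (κ : Kernel X X) (ε : ℝ) (x₀ : X)
    (ν : Measure X) : ℝ :=
  sInf {b | ∃ r : Reference.{u, w} X, r.Admissible κ ε x₀ ν ∧ b = r.benchmark ε}

/-! ### Tuple regression -/

section Regression

/-- Tuples `(s, u, g, H)`: a state, an intermediate state, a goal and a temporal-gap label. -/
abbrev DataTuple (X : Type u) : Type u := X × X × X × ℝ

variable {X : Type u} {𝒯 : Type v} {E : Type w} [NormedAddCommGroup E] [InnerProductSpace ℝ E]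

/-- The predictor `f_φ(s, u, g) = ⟨φ(u) - φ(s), ω(g)⟩`. -/
def predictor (ω : X → E) (φ : X → E) (s u g : X) : ℝ := ⟪φ u - φ s, ω g⟫_ℝ

/-- The empirical risk of an encoder on `N` trajectories, with `m` extracted tuples each. -/
def empiricalRisk {N m : ℕ} (z : Fin m → 𝒯 → DataTuple X) (ω : X → E) (τ : Fin N → 𝒯)
    (φ : X → E) : ℝ :=
  1 / ((N : ℝ) * m) * ∑ j, ∑ t,
    (predictor ω φ (z t (τ j)).1 (z t (τ j)).2.1 (z t (τ j)).2.2.1 - (z t (τ j)).2.2.2) ^ 2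

/-- The slotwise class `{τ ↦ f_φ(s_t(τ), u_t(τ), g_t(τ)) : φ ∈ Φ}`. -/
def slotClass {m : ℕ} (z : Fin m → 𝒯 → DataTuple X) (ω : X → E) (Φ : Set (X → E)) (t : Fin m) :
    Set (𝒯 → ℝ) :=
  (fun φ τ => predictor ω φ (z t τ).1 (z t τ).2.1 (z t τ).2.2.1) '' Φ

variable [MeasurableSpace X] [MeasurableSpace 𝒯]

/-- Rademacher complexity `E_{τ, σ} [sup_{q ∈ 𝒢} (1/N) ∑_j σ_j q(τ_j)]` for `N` independent
samples from `Q` and independent uniform signs. -/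
def rademacher (Q : Measure 𝒯) (N : ℕ) (𝒢 : Set (𝒯 → ℝ)) : ℝ :=
  ∫ τ : Fin N → 𝒯, (1 / 2 ^ N : ℝ) * ∑ σ : Fin N → ℤˣ,
    ⨆ q : 𝒢, (1 / N : ℝ) * ∑ j, ((σ j : ℤ) : ℝ) * q.1 (τ j) ∂(Measure.pi fun _ => Q)

/-- The average over the extraction slots of the slotwise Rademacher complexities. -/
def averageRademacher {m : ℕ} (Q : Measure 𝒯) (N : ℕ) (z : Fin m → 𝒯 → DataTuple X) (ω : X → E)
    (Φ : Set (X → E)) : ℝ :=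
  (1 / m : ℝ) * ∑ t, rademacher Q N (slotClass z ω Φ t)

/-- The statistical error term `Γ_N(δ)`. -/
def statisticalError {m : ℕ} (Q : Measure 𝒯) (N : ℕ) (z : Fin m → 𝒯 → DataTuple X) (ω : X → E)
    (Φ : Set (X → E)) (Cφ Cω Hmax δ : ℝ) : ℝ :=
  16 * (2 * Cφ * Cω + Hmax) * averageRademacher Q N z ω Φ +
    2 * (2 * Cφ * Cω + Hmax) ^ 2 * Real.sqrt (Real.log (1 / δ) / (2 * N))

/-- The law `μ` of a uniformly selected extracted tuple of a trajectory with law `Q`. -/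
def tupleLaw {m : ℕ} (Q : Measure 𝒯) (z : Fin m → 𝒯 → DataTuple X) : Measure (DataTuple X) :=
  (m : ℝ≥0∞)⁻¹ • ∑ t, Q.map (z t)

instance {m : ℕ} (Q : Measure 𝒯) [IsFiniteMeasure Q] (z : Fin m → 𝒯 → DataTuple X) :
    IsFiniteMeasure (tupleLaw Q z) := by
  unfold tupleLaw
  rcases Nat.eq_zero_or_pos m with rfl | hm
  · simp only [Finset.univ_eq_empty, Finset.sum_empty, smul_zero]; infer_instance
  · exact Measure.smul_finite _ (ENNReal.inv_ne_top.2 (by exact_mod_cast hm.ne'))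

/-- The `(S, U)`-marginal of a law of tuples. -/
def pairLaw (μ : Measure (DataTuple X)) : Measure (X × X) :=
  μ.map fun z => (z.1, z.2.1)

/-- The conditional goal law `ν_{s,u} = Law(G | S = s, U = u)`. -/
def goalLaw [StandardBorelSpace X] [Nonempty X] (μ : Measure (DataTuple X)) [IsFiniteMeasure μ] :
    Kernel (X × X) X :=
  condDistrib (fun z : DataTuple X => z.2.2.1) (fun z => (z.1, z.2.1)) μ

/-- The conditional mean `E[H | S, U, G]`, as a function on the space of tuples. -/
def labelMean (μ : Measure (DataTuple X)) : DataTuple X → ℝ :=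
  μ[fun z => z.2.2.2 |
    MeasurableSpace.comap (fun z : DataTuple X => (z.1, z.2.1, z.2.2.1)) inferInstance]

/-- The learned displacement space: the closure of the span of the vectors `φ(u) - φ(s)` with
`(s, u)` in the support of `lam`. -/
def learnedSpace [TopologicalSpace X] (lam : Measure (X × X)) (φ : X → E) : Submodule ℝ E :=
  (Submodule.span ℝ ((fun p : X × X => φ p.2 - φ p.1) '' lam.support)).topologicalClosure

open Classical in
/-- The map `T : D → F` evaluated at a vector of `D` (and `0` off `D`; the vectors `φ(u) - φ(s)`
lie in the learned space for `lam`-almost every `(s, u)`). -/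
def applyOn {F : Type*} [NormedAddCommGroup F] [NormedSpace ℝ F] {D : Submodule ℝ E}
    (T : D →L[ℝ] F) (v : E) : F :=
  if h : v ∈ D then T ⟨v, h⟩ else 0

end Regression

end HittingGeometry

end

open HittingGeometry

/-! Learned and reference displacements are compared through their predictions over goals. If `A`
and `B` are the two analysis operators into `L²(ν)`, the map `T = B⁻¹ ∘ proj_{range B} ∘ A`
satisfies `m_B ‖T d - d'‖ ≤ ‖A d - B d'‖`, because `B d'` is fixed by a projection that sends `A d`
to `B (T d)` (`exists_alignment`). With `d`, `d'` the learned and reference displacements of a pair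
`(s, u)`, integration over the pairs and goal coverage, which trades `ν` for the conditional goal
law at the cost of `1 / c_cov` (`lintegral_pairLaw_le_of_coverage`), reduce the claim to an `L²(μ)`
bound on the difference of the two predictors. That difference is split through the conditional
label mean and the displacement target `G`; the middle piece is bounded by hypothesis.

Reference against `G`: for a fixed goal, the expected hitting time solves an exact Bellman equation,
and `-⟨φ^r, ω_g⟩` solves the same equation up to `ε ‖ω_g‖`. The resolvent bound turns this residual
into a uniform error of at most the benchmark, hence twice the benchmark for a difference of two
states (`Reference.Admissible.abs_predictor_sub_displacementTarget_le`).

Learner against the label mean: squared risk is squared distance to the conditional mean plus a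
noise term independent of the encoder, so excess risk controls the distance. Excess risk is bounded
by McDiarmid's inequality, symmetrization and contraction, with whole trajectories as the
independent samples (`measure_pi_excess_risk_gt_le`). A limiting argument covers an approximation
infimum that is not attained (`measure_pi_minimizer_error_gt_le`).

One structural fact simplifies the measure theory: an admissible reference forces the state space to
be finite (`Reference.Admissible.finite`). Expected hitting times are then bounded uniformly in the
goal, so within some fixed number `n` of steps every state is visited with probability at least
`1/2`, while `n` steps allow only `n` visits in total. Functions of states are therefore measurable
and bounded. -/

namespace HittingGeometry

/-! ### Hitting times, survival probabilities and finiteness of the state space -/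

section Hitting

/-- Layer-cake form: a time with values in `ℕ ∪ {∞}` counts the `n` that lie strictly before it. It
also yields measurability of the hitting time. -/
lemma hittingTime_eq_tsum {S : Type u} (g : S) (y : ℕ → S) :
    hittingTime g y = ∑' n : ℕ, {y : ℕ → S | ∀ t ≤ n, y t ≠ g}.indicator (fun _ => 1) y := by
  classical
  by_cases h : ∃ t, y t = g
  · have h1 : hittingTime g y = (Nat.find h : ℝ≥0∞) := by
      apply le_antisymm
      · exact iInf₂_le (Nat.find h) (Nat.find_spec h)
      · exact le_iInf₂ fun t ht => by exact_mod_cast Nat.find_min' h ht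
    rw [h1, tsum_eq_sum (s := Finset.range (Nat.find h))]
    · rw [Finset.sum_congr rfl (g := fun _ => (1 : ℝ≥0∞))]
      · simp
      · intro n hn
        rw [Set.indicator_of_mem]
        intro t ht
        exact Nat.find_min h (lt_of_le_of_lt ht (Finset.mem_range.1 hn))
    · intro n hn
      rw [Set.indicator_of_notMem]
      intro hy
      exact hy _ (by simpa using hn) (Nat.find_spec h)
  · push Not at h
    have h1 : hittingTime g y = ⊤ := by simp [hittingTime, h]
    rw [h1, tsum_congr (g := fun _ => (1 : ℝ≥0∞))]
    · exact (ENNReal.tsum_const_eq_top_of_ne_zero one_ne_zero).symm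
    · intro n; rw [Set.indicator_of_mem]; exact fun t _ => h t

variable {S : Type u} [MeasurableSpace S]

/-- `survival κ g n x` is the probability that the chain started at `x` avoids `g` at the times
`1, …, n`. -/
noncomputable def survival (κ : Kernel S S) (g : S) : ℕ → S → ℝ≥0∞
  | 0 => fun _ => 1
  | n + 1 => fun x => ∫⁻ x' in {g}ᶜ, survival κ g n x' ∂(κ x)

instance (ρ : Measure S) [IsProbabilityMeasure ρ] (κ : Kernel S S) [IsMarkovKernel κ] :
    IsProbabilityMeasure (chainLaw ρ κ) := by
  unfold chainLaw; infer_instance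

lemma map_eval_zero_chainLaw (ρ : Measure S) [IsProbabilityMeasure ρ] (κ : Kernel S S)
    [IsMarkovKernel κ] : (chainLaw ρ κ).map (fun y => y 0) = ρ := by
  have h : (fun y : ℕ → S => y 0) =
      (MeasurableEquiv.piUnique (fun _ : Finset.Iic 0 => S)) ∘ Preorder.frestrictLe 0 := by
    ext y; rfl
  rw [h, ← Measure.map_map (by fun_prop) (by fun_prop)]
  unfold chainLaw Kernel.trajMeasure
  rw [Measure.map_comp _ _ (by fun_prop), Kernel.traj_map_frestrictLe_of_le le_rfl]
  have h₁ : Measurable (Preorder.frestrictLe₂ (π := fun _ : ℕ => S) (le_refl 0)) := by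
    exact Preorder.measurable_frestrictLe₂ le_rfl
  have h₂ := (MeasurableEquiv.piUnique (fun _ : Finset.Iic 0 => S)).measurable
  rw [Measure.deterministic_comp_eq_map, Measure.map_map h₂ h₁,
    Measure.map_map (h₂.comp h₁) (MeasurableEquiv.measurable _)]
  exact Measure.map_id

lemma survival_le_one (κ : Kernel S S) [IsMarkovKernel κ] (g : S) (n : ℕ) (x : S) :
    survival κ g n x ≤ 1 := by
  induction n generalizing x with
  | zero => exact le_rfl
  | succ n ih =>
    calc ∫⁻ x' in {g}ᶜ, survival κ g n x' ∂(κ x) ≤ ∫⁻ x', survival κ g n x' ∂(κ x) :=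
          setLIntegral_le_lintegral _ _
      _ ≤ ∫⁻ _, 1 ∂(κ x) := lintegral_mono fun x' => ih x'
      _ = 1 := by simp

variable [MeasurableSingletonClass S]

lemma measurable_survival (κ : Kernel S S) (g : S) (n : ℕ) :
    Measurable (survival κ g n) := by
  induction n with
  | zero => exact measurable_const
  | succ n ih =>
    simp only [survival]
    simp_rw [← lintegral_indicator (measurableSet_singleton g).compl]
    exact (ih.indicator (measurableSet_singleton g).compl).lintegral_kernel

lemma measurableSet_avoids (g : S) (n : ℕ) :
    MeasurableSet {y : ℕ → S | ∀ t ≤ n, y t ≠ g} := by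
  have : {y : ℕ → S | ∀ t ≤ n, y t ≠ g} = ⋂ t ∈ Set.Iic n, (fun y : ℕ → S => y t) ⁻¹' {g}ᶜ := by
    ext y; simp
  rw [this]
  exact MeasurableSet.biInter (Set.to_countable _) fun t _ =>
    measurable_pi_apply t (measurableSet_singleton g).compl

/-- The Markov property at time `n`, on the event that the chain has avoided `g`. -/
lemma setLIntegral_avoids_succ (ρ : Measure S) [IsProbabilityMeasure ρ] (κ : Kernel S S)
    [IsMarkovKernel κ] (g : S) (n : ℕ) {f : S → ℝ≥0∞} (hf : Measurable f) :
    ∫⁻ y in {y | ∀ t ≤ n + 1, y t ≠ g}, f (y (n + 1)) ∂(chainLaw ρ κ) =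
      ∫⁻ y in {y | ∀ t ≤ n, y t ≠ g}, (∫⁻ x' in {g}ᶜ, f x' ∂(κ (y n))) ∂(chainLaw ρ κ) := by
  have hg := (measurableSet_singleton g).compl
  set K : Kernel (Π _ : Finset.Iic n, S) S :=
    κ.comap (fun h => h ⟨n, Finset.mem_Iic.2 le_rfl⟩) (measurable_pi_apply _) with hK
  have key : (chainLaw ρ κ).map (Preorder.frestrictLe n) ⊗ₘ K =
      (chainLaw ρ κ).map (fun y => (Preorder.frestrictLe n y, y (n + 1))) :=
    Kernel.map_frestrictLe_trajMeasure_compProd_eq_map_trajMeasure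
  set A : Set (Π _ : Finset.Iic n, S) := {h | ∀ i, h i ≠ g} with hA
  have hAm : MeasurableSet A := by
    have : A = ⋂ i, (fun h : Π _ : Finset.Iic n, S => h i) ⁻¹' {g}ᶜ := by ext y; simp [hA]
    rw [this]
    exact MeasurableSet.iInter fun i => measurable_pi_apply i hg
  -- One test function on (past, next state) carries both avoidance conditions; integrating it
  -- against the two sides of `key` gives the two sides of the claim.
  set F : (Π _ : Finset.Iic n, S) × S → ℝ≥0∞ :=
    (A ×ˢ ({g}ᶜ : Set S)).indicator (fun p => f p.2) with hF
  have hFm : Measurable F := (hf.comp measurable_snd).indicator (hAm.prod hg)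
  have h1 : ∫⁻ y, F (Preorder.frestrictLe n y, y (n + 1)) ∂(chainLaw ρ κ) =
      ∫⁻ y in {y | ∀ t ≤ n + 1, y t ≠ g}, f (y (n + 1)) ∂(chainLaw ρ κ) := by
    rw [← lintegral_indicator (measurableSet_avoids g (n + 1))]
    refine lintegral_congr fun y => ?_
    simp only [hF, Set.indicator]
    congr 1
    simp only [hA, Set.mem_prod, Set.mem_ofPred_eq, Set.mem_compl_iff, Set.mem_singleton_iff,
      Subtype.forall, Finset.mem_Iic, Preorder.frestrictLe_apply, eq_iff_iff]
    constructor
    · rintro ⟨h, h'⟩ t ht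
      rcases Nat.le_succ_iff.1 ht with ht | rfl
      · exact h t ht
      · exact h'
    · exact fun h => ⟨fun t ht => h t (by omega), h _ le_rfl⟩
  have h2 : ∫⁻ p, F p ∂((chainLaw ρ κ).map (Preorder.frestrictLe n) ⊗ₘ K) =
      ∫⁻ y in {y | ∀ t ≤ n, y t ≠ g}, (∫⁻ x' in {g}ᶜ, f x' ∂(κ (y n))) ∂(chainLaw ρ κ) := by
    rw [Measure.lintegral_compProd hFm, lintegral_map hFm.lintegral_kernel_prod_right'
      (by fun_prop), ← lintegral_indicator (measurableSet_avoids g n)]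
    refine lintegral_congr fun y => ?_
    by_cases hy : ∀ t ≤ n, y t ≠ g
    · have hy' : Preorder.frestrictLe n y ∈ A := fun i => hy _ (Finset.mem_Iic.1 i.2)
      rw [Set.indicator_of_mem (show y ∈ {y : ℕ → S | ∀ t ≤ n, y t ≠ g} from hy),
        ← lintegral_indicator hg]
      refine lintegral_congr fun b => ?_
      by_cases hb : b ∈ ({g}ᶜ : Set S)
      · rw [Set.indicator_of_mem hb]
        exact Set.indicator_of_mem (Set.mk_mem_prod hy' hb) _
      · rw [Set.indicator_of_notMem hb]
        exact Set.indicator_of_notMem (fun h => hb h.2) _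
    · have hy' : Preorder.frestrictLe n y ∉ A := fun h =>
        hy fun t ht => h ⟨t, Finset.mem_Iic.2 ht⟩
      rw [Set.indicator_of_notMem (show y ∉ {y : ℕ → S | ∀ t ≤ n, y t ≠ g} from hy)]
      simp [hF, hy']
  rw [← h1, ← h2, key, lintegral_map hFm (by fun_prop)]

/-- Each use of the Markov property moves one step from the observed past into the survival
function, so `n + k` is conserved until only the initial law remains. -/
lemma setLIntegral_survival (ρ : Measure S) [IsProbabilityMeasure ρ] (κ : Kernel S S)
    [IsMarkovKernel κ] (g : S) (n k : ℕ) :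
    ∫⁻ y in {y | ∀ t ≤ n, y t ≠ g}, survival κ g k (y n) ∂(chainLaw ρ κ) =
      ∫⁻ x in {g}ᶜ, survival κ g (n + k) x ∂ρ := by
  induction n generalizing k with
  | zero =>
    conv_rhs => rw [← map_eval_zero_chainLaw ρ κ]
    rw [setLIntegral_map (measurableSet_singleton g).compl (measurable_survival κ g _)
      (measurable_pi_apply 0)]
    simp only [Nat.le_zero, forall_eq, zero_add]
    rfl
  | succ n ih =>
    rw [setLIntegral_avoids_succ ρ κ g n (measurable_survival κ g k)]
    exact (ih (k + 1)).trans (by rw [Nat.add_right_comm, Nat.add_assoc])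

lemma chainLaw_avoids (κ : Kernel S S) [IsMarkovKernel κ] {g x : S} (hx : x ≠ g) (n : ℕ) :
    chainLaw (Measure.dirac x) κ {y | ∀ t ≤ n, y t ≠ g} = survival κ g n x := by
  have h := setLIntegral_survival (Measure.dirac x) κ g n 0
  simp only [survival, setLIntegral_one, add_zero] at h
  rw [h, ← lintegral_indicator (measurableSet_singleton g).compl,
    lintegral_dirac' _ ((measurable_survival κ g n).indicator (measurableSet_singleton g).compl),
    Set.indicator_of_mem (by simpa using hx)]

lemma lintegral_hittingTime (κ : Kernel S S) [IsMarkovKernel κ] {g x : S} (hx : x ≠ g) :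
    ∫⁻ y, hittingTime g y ∂(chainLaw (Measure.dirac x) κ) = ∑' n, survival κ g n x := by
  simp_rw [hittingTime_eq_tsum]
  rw [lintegral_tsum fun n =>
    (measurable_const.indicator (measurableSet_avoids g n)).aemeasurable]
  refine tsum_congr fun n => ?_
  rw [lintegral_indicator (measurableSet_avoids g n), setLIntegral_one, chainLaw_avoids κ hx]

lemma lintegral_hittingTime_self (κ : Kernel S S) [IsMarkovKernel κ] (g : S) :
    ∫⁻ y, hittingTime g y ∂(chainLaw (Measure.dirac g) κ) = 0 := by
  have h : ∀ᵐ x ∂(chainLaw (Measure.dirac g) κ).map (fun y => y 0), x = g := by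
    rw [map_eval_zero_chainLaw]
    exact (ae_dirac_iff (p := fun x => x = g) (measurableSet_singleton g)).2 rfl
  have h' := ae_of_ae_map (measurable_pi_apply 0).aemeasurable h
  rw [lintegral_congr_ae (g := fun _ => 0)]
  · simp
  · filter_upwards [h'] with y hy
    exact le_antisymm ((iInf₂_le 0 hy).trans (by simp)) bot_le

/-- First-step analysis: away from `g` this is the Bellman equation of the expected hitting time,
stated in `ℝ≥0∞` so that no finiteness is needed. -/
lemma tsum_survival_eq (κ : Kernel S S) [IsMarkovKernel κ] (g x : S) :
    ∑' n, survival κ g n x = 1 + ∫⁻ x' in {g}ᶜ, ∑' n, survival κ g n x' ∂(κ x) := by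
  rw [tsum_eq_zero_add' ENNReal.summable,
    lintegral_tsum fun n => (measurable_survival κ g n).aemeasurable]
  rfl

lemma killedOperator_eq_integral (κ : Kernel S S) (g : S) (f : S → ℝ) (x : {x : S // x ≠ g}) :
    killedOperator κ g (fun x => f x) x = ∫ x' in {g}ᶜ, f x' ∂(κ x) := by
  rw [← integral_indicator (measurableSet_singleton g).compl]
  refine integral_congr_ae (.of_forall fun x' => ?_)
  by_cases h : x' = g
  · subst h
    rw [Function.extend_apply' _ _ _ (by rintro ⟨a, ha⟩; exact a.2 ha)]
    simp
  · rw [Set.indicator_of_mem (by simpa using h)]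
    exact Subtype.val_injective.extend_apply (fun x : {x : S // x ≠ g} => f x) 0 ⟨x', h⟩

lemma killedOperator_survival (κ : Kernel S S) [IsMarkovKernel κ] (g : S) (n : ℕ)
    (x : {x : S // x ≠ g}) :
    killedOperator κ g (fun x => (survival κ g n x).toReal) x =
      (survival κ g (n + 1) x).toReal := by
  rw [killedOperator_eq_integral κ g (fun x => (survival κ g n x).toReal), integral_toReal]
  · rfl
  · exact (measurable_survival κ g n).aemeasurable
  · exact .of_forall fun x' => (survival_le_one κ g n x').trans_lt ENNReal.one_lt_top

/-- The killed operator shifts survival probabilities by one step, so `I - P_Q` telescopes a partial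
sum to `1` minus a probability, which the resolvent bound inverts. -/
lemma sum_survival_le_of_resolventBound (κ : Kernel S S) [IsMarkovKernel κ] {g : S} {K : ℝ}
    (h : ResolventBound κ g K) {x : S} (hx : x ≠ g) (n : ℕ) :
    ∑ k ∈ Finset.range n, (survival κ g k x).toReal ≤ K := by
  have hle : ∀ k x, (survival κ g k x).toReal ≤ 1 := fun k x =>
    ENNReal.toReal_le_of_le_ofReal zero_le_one (by simpa using survival_le_one κ g k x)
  have hnn : ∀ k x, 0 ≤ (survival κ g k x).toReal := fun k x => ENNReal.toReal_nonneg
  -- Partial sums are used because the resolvent bound applies to bounded functions only, and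
  -- boundedness of the whole series is the goal.
  set f : S → ℝ := fun x => ∑ k ∈ Finset.range n, (survival κ g k x).toReal with hf
  have hfm : Measurable f := Finset.measurable_sum _ fun k _ =>
    (measurable_survival κ g k).ennreal_toReal
  have hfb : ∀ x, |f x| ≤ n := fun x => by
    rw [abs_of_nonneg (Finset.sum_nonneg fun k _ => hnn k x)]
    exact (Finset.sum_le_sum fun k _ => hle k x).trans (by simp)
  have hkill : ∀ x : {x : S // x ≠ g}, killedOperator κ g (fun x => f x) x =
      ∑ k ∈ Finset.range n, (survival κ g (k + 1) x).toReal := fun x => by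
    rw [killedOperator_eq_integral, integral_finsetSum]
    · refine Finset.sum_congr rfl fun k _ => ?_
      rw [← killedOperator_survival,
        killedOperator_eq_integral κ g (fun x => (survival κ g k x).toReal)]
    · intro k _
      refine Integrable.of_bound (measurable_survival κ g k).ennreal_toReal.aestronglyMeasurable 1
        (.of_forall fun x => ?_)
      rw [Real.norm_of_nonneg (hnn k x)]
      exact hle k x
  have := h.2 (fun x => f x) ⟨hfm.comp measurable_subtype_coe, n, fun x => hfb x⟩ 1 (fun y => by
    rw [Pi.sub_apply, hkill]
    simp only [hf]
    rw [← Finset.sum_sub_distrib, Finset.sum_range_sub']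
    rw [abs_le]
    have h0 : (survival κ g 0 (y : S)).toReal = 1 := by simp [survival]
    constructor <;> linarith [hle n y, hnn n y]) ⟨x, hx⟩
  rw [mul_one] at this
  exact (le_abs_self _).trans this

lemma tsum_survival_le_of_resolventBound (κ : Kernel S S) [IsMarkovKernel κ] {g : S} {K : ℝ}
    (h : ResolventBound κ g K) {x : S} (hx : x ≠ g) :
    ∑' n, survival κ g n x ≤ ENNReal.ofReal K := by
  rw [ENNReal.tsum_eq_iSup_nat]
  refine iSup_le fun n => ?_
  have hfin : ∀ k ∈ Finset.range n, survival κ g k x ≠ ⊤ := fun k _ =>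
    ((survival_le_one κ g k x).trans_lt ENNReal.one_lt_top).ne
  rw [← ENNReal.ofReal_toReal (ENNReal.sum_ne_top.2 hfin), ENNReal.toReal_sum hfin]
  exact ENNReal.ofReal_le_ofReal (sum_survival_le_of_resolventBound κ h hx n)

/-- A state space all of whose expected hitting times have a common bound is finite. -/
lemma finite_of_lintegral_hittingTime_le (κ : Kernel S S) [IsMarkovKernel κ] (x : S) (K : ℝ)
    (h : ∀ g, ∫⁻ y, hittingTime g y ∂(chainLaw (Measure.dirac x) κ) ≤ ENNReal.ofReal K) :
    Finite S := by
  by_contra hS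
  rw [not_finite_iff_infinite] at hS
  set μ := chainLaw (Measure.dirac x) κ
  -- Beyond `2 * K`, Markov's inequality leaves at most probability `1/2` for not having hit `g`
  -- before time `n`; the maximum with `0` makes `n` positive.
  obtain ⟨n, hn⟩ := exists_nat_gt (max (2 * K) 0)
  have hn0 : 0 < n := by exact_mod_cast (le_max_right _ _).trans_lt hn
  have hvisit : ∀ g, (2 : ℝ≥0∞)⁻¹ ≤ ∑ t ∈ Finset.range n, μ ((fun y => y t) ⁻¹' {g}) := by
    intro g
    have hm : Measurable (hittingTime g : (ℕ → S) → ℝ≥0∞) := by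
      have : (hittingTime g : (ℕ → S) → ℝ≥0∞) = fun y =>
          ∑' n : ℕ, {y : ℕ → S | ∀ t ≤ n, y t ≠ g}.indicator (fun _ => 1) y := by
        ext y; exact hittingTime_eq_tsum g y
      rw [this]
      exact Measurable.tsum fun n =>
        measurable_const.indicator (measurableSet_avoids g n)
    have hmarkov : (n : ℝ≥0∞) * μ {y | (n : ℝ≥0∞) ≤ hittingTime g y} ≤ ENNReal.ofReal K :=
      (mul_meas_ge_le_lintegral hm n).trans (h g)
    have hhalf : μ {y | (n : ℝ≥0∞) ≤ hittingTime g y} ≤ 2⁻¹ := by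
      have h2 : ENNReal.ofReal K ≤ (n : ℝ≥0∞) * 2⁻¹ := by
        rw [← ENNReal.ofReal_natCast, ← ENNReal.ofReal_ofNat 2,
          ← ENNReal.ofReal_inv_of_pos two_pos, ← ENNReal.ofReal_mul (Nat.cast_nonneg n)]
        exact ENNReal.ofReal_le_ofReal (by linarith [le_max_left (2 * K) 0])
      exact (ENNReal.mul_le_mul_iff_right (by exact_mod_cast hn0.ne') (ENNReal.natCast_ne_top n)).1
        (hmarkov.trans h2)
    have hcover : (Set.univ : Set (ℕ → S)) ⊆ {y | (n : ℝ≥0∞) ≤ hittingTime g y} ∪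
        ⋃ t ∈ Finset.range n, (fun y => y t) ⁻¹' {g} := by
      intro y _
      by_cases hy : ∃ t < n, y t = g
      · obtain ⟨t, ht, hy⟩ := hy
        exact Or.inr (Set.mem_biUnion (Finset.mem_coe.2 (Finset.mem_range.2 ht)) hy)
      · push Not at hy
        refine Or.inl ?_
        change (n : ℝ≥0∞) ≤ ⨅ t : ℕ, ⨅ _ : y t = g, (t : ℝ≥0∞)
        refine le_iInf₂ fun t ht => ?_
        by_contra hlt
        exact hy t (by exact_mod_cast not_le.1 hlt) ht
    have h1 : (1 : ℝ≥0∞) ≤ 2⁻¹ + ∑ t ∈ Finset.range n, μ ((fun y => y t) ⁻¹' {g}) := by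
      rw [← measure_univ (μ := μ)]
      refine (measure_mono hcover).trans ((measure_union_le _ _).trans ?_)
      exact add_le_add hhalf (measure_biUnion_finset_le _ _)
    rw [← ENNReal.inv_two_add_inv_two] at h1
    exact (ENNReal.add_le_add_iff_left (by simp)).1 h1
  -- Each of these points has expected visit count at least `1/2`, giving `n + 1/2` in total, but
  -- each of the `n` times contributes at most `1`.
  obtain ⟨F, hF⟩ := Infinite.exists_subset_card_eq S (2 * n + 1)
  have hsum : ∑ g ∈ F, (2 : ℝ≥0∞)⁻¹ ≤ n := by
    calc ∑ g ∈ F, (2 : ℝ≥0∞)⁻¹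
        ≤ ∑ g ∈ F, ∑ t ∈ Finset.range n, μ ((fun y => y t) ⁻¹' {g}) :=
          Finset.sum_le_sum fun g _ => hvisit g
      _ = ∑ t ∈ Finset.range n, ∑ g ∈ F, μ ((fun y => y t) ⁻¹' {g}) := Finset.sum_comm
      _ ≤ ∑ t ∈ Finset.range n, 1 := by
          refine Finset.sum_le_sum fun t _ => ?_
          rw [sum_measure_preimage_singleton F fun g _ =>
            measurable_pi_apply t (measurableSet_singleton g)]
          exact prob_le_one
      _ = n := by simp
  rw [Finset.sum_const, hF, nsmul_eq_mul] at hsum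
  have h2 : ((2 * n + 1 : ℕ) : ℝ≥0∞) ≤ ((2 * n : ℕ) : ℝ≥0∞) := by
    have := mul_le_mul_left hsum 2
    rw [mul_assoc, ENNReal.inv_mul_cancel two_ne_zero ENNReal.ofNat_ne_top, mul_one] at this
    rw [mul_comm 2 n, Nat.cast_mul n 2]
    rw [mul_comm 2 n] at this
    exact_mod_cast this
  have h3 : 2 * n + 1 ≤ 2 * n := by exact_mod_cast h2
  omega

end Hitting

/-! ### Hitting-time predictions of an admissible reference -/

namespace Reference

variable {X : Type u} [MeasurableSpace X] {r : Reference.{u, w} X} {κ : Kernel X X} {ε : ℝ}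

lemma ω_mem_transientSpace {g : X} (h : r.AdmissibleAt κ ε g) : r.ω g ∈ r.transientSpace g := by
  obtain ⟨w₁, ω', -, hω, -⟩ := h.adjoint_eq
  rw [← hω]
  exact ω'.2

/-- The latent prediction thus satisfies the boundary condition of the hitting time exactly, so
killing at the goal costs it nothing. -/
lemma inner_φ_self_ω {g : X} (h : r.AdmissibleAt κ ε g) : ⟪r.φ g, r.ω g⟫_ℝ = 0 :=
  (Submodule.mem_orthogonal _ _).1 (ω_mem_transientSpace h) _
    (Submodule.mem_span_singleton_self _)

/-- The latent Bellman equation `⟨T φ(x), ω_g⟩ = 1 + ⟨φ(x), ω_g⟩`. -/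
lemma inner_T_φ_ω {g : X} (h : r.AdmissibleAt κ ε g) {x : X} (hx : x ≠ g) :
    ⟪r.T g (r.φ x), r.ω g⟫_ℝ = 1 + ⟪r.φ x, r.ω g⟫_ℝ := by
  obtain ⟨w₁, ω', hw, hω, hadj⟩ := h.adjoint_eq
  -- The goal component `a` stays in the goal space under `T` and is invisible to `ω_g` and `w₁`;
  -- only `b` counts, and there the adjoint equation applies.
  obtain ⟨a, ha, b, hb, hab⟩ := (r.goalSpace g).exists_add_mem_mem_orthogonal (r.φ x)
  have horth : ∀ c ∈ r.goalSpace g, ∀ d : r.transientSpace g, ⟪c, (d : r.H)⟫_ℝ = 0 :=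
    fun c hc d => (Submodule.mem_orthogonal _ _).1 d.2 c hc
  have h1 : ⟪r.T g (r.φ x), r.ω g⟫_ℝ = ⟪r.T g b, r.ω g⟫_ℝ := by
    rw [hab, map_add, inner_add_left, ← hω, horth _ (h.invariant a ha), zero_add]
  have h2 : ∀ d : r.transientSpace g, ⟪r.φ x, (d : r.H)⟫_ℝ = ⟪b, (d : r.H)⟫_ℝ := fun d => by
    rw [hab, inner_add_left, horth a ha, zero_add]
  set b' : r.transientSpace g := ⟨b, hb⟩
  have h3 : ⟪r.transientOperator g b', ω'⟫_ℝ = ⟪r.T g b, r.ω g⟫_ℝ := by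
    rw [← hω]
    simp only [transientOperator, compression, ContinuousLinearMap.comp_apply]
    rw [Submodule.coe_inner]
    exact Submodule.inner_orthogonalProjectionOnto_eq_of_mem_right ω' _
  have h4 : ⟪(r.transientOperator g - ContinuousLinearMap.id ℝ (r.transientSpace g)) b', ω'⟫_ℝ
      = 1 := by
    have e := ContinuousLinearMap.adjoint_inner_right (𝕜 := ℝ) (E := r.transientSpace g)
      (F := r.transientSpace g)
      (r.transientOperator g - ContinuousLinearMap.id ℝ (r.transientSpace g)) b' ω'
    rw [hadj] at e
    rw [← e, Submodule.coe_inner]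
    exact (h2 w₁).symm.trans (hw x hx)
  rw [sub_apply, inner_sub_left, h3] at h4
  rw [h1, ← hω, h2 ω', hω]
  have h5 : ⟪(ContinuousLinearMap.id ℝ (r.transientSpace g)) b', ω'⟫_ℝ = ⟪b, r.ω g⟫_ℝ := by
    rw [← hω]; rfl
  linarith

lemma integral_inner_φ (ξ : r.H) {x : X} (hinteg : Integrable r.ambientFeature (κ x)) :
    ∫ x', ⟪r.φ x', ξ⟫_ℝ ∂(κ x) =
      ⟪r.H.orthogonalProjectionOnto (∫ x', r.ambientFeature x' ∂(κ x)), ξ⟫_ℝ := by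
  rw [← ContinuousLinearMap.integral_comp_comm _ hinteg, real_inner_comm, ← integral_inner]
  · simp only [real_inner_comm ξ]
    rfl
  · exact ContinuousLinearMap.integrable_comp _ hinteg

variable [MeasurableSingletonClass X] [IsMarkovKernel κ] [Finite X]

/-- A reference predicts the expected hitting times of `g` up to its resolvent error. -/
lemma abs_hittingTime_add_inner_le {g : X} (h : r.AdmissibleAt κ ε g)
    (hinteg : ∀ x, Integrable r.ambientFeature (κ x)) (x : X) (hx : x ≠ g) :
    |(∫⁻ y, hittingTime g y ∂(chainLaw (Measure.dirac x) κ)).toReal + ⟪r.φ x, r.ω g⟫_ℝ| ≤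
      r.CH g / (1 - r.ρ g) * (ε * ‖r.ω g‖) := by
  have hV := fun (x : X) (hx : x ≠ g) => tsum_survival_le_of_resolventBound κ h.resolvent hx
  set V : X → ℝ≥0∞ := fun x => ∑' n, survival κ g n x with hVdef
  have hVtop : ∀ x ≠ g, V x ≠ ⊤ := fun x hx => ((hV x hx).trans_lt ENNReal.ofReal_lt_top).ne
  set f : X → ℝ := fun x => (V x).toReal + ⟪r.φ x, r.ω g⟫_ℝ with hf
  have hg := (measurableSet_singleton g).compl
  -- The features are assumed integrable, not bounded; finiteness of the state space supplies the
  -- boundedness.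
  have hfb : (fun x : {x : X // x ≠ g} => f x) ∈ boundedMeasurable g := by
    refine ⟨measurable_of_finite _, ?_⟩
    obtain ⟨M, hM⟩ := (Set.finite_range fun x : {x : X // x ≠ g} => |f x|).bddAbove
    exact ⟨M, fun x => hM ⟨x, rfl⟩⟩
  have hkill : ∀ x : {x : X // x ≠ g},
      |((fun x : {x : X // x ≠ g} => f x) - killedOperator κ g (fun x => f x)) x| ≤
        ε * ‖r.ω g‖ := by
    rintro ⟨x, hx⟩
    rw [Pi.sub_apply, killedOperator_eq_integral]
    simp only [hf]
    rw [integral_add Integrable.of_finite Integrable.of_finite]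
    have e1 : (V x).toReal = 1 + ∫ x' in {g}ᶜ, (V x').toReal ∂(κ x) := by
      have e := tsum_survival_eq κ g x
      rw [integral_toReal (measurable_of_finite _).aemeasurable
        ((ae_restrict_mem hg).mono fun x' hx' => (hVtop x' hx').lt_top)]
      have hne : 1 + ∫⁻ x' in {g}ᶜ, V x' ∂(κ x) ≠ ⊤ := by
        rw [← e]; exact hVtop x hx
      change V x = 1 + ∫⁻ x' in {g}ᶜ, V x' ∂(κ x) at e
      rw [e, ENNReal.toReal_add ENNReal.one_ne_top (ne_top_of_le_ne_top hne le_add_self),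
        ENNReal.toReal_one]
    -- Restoring the full integral is what lets the capacity condition, which concerns the unkilled
    -- kernel, be applied.
    have e2 : ∫ x' in {g}ᶜ, ⟪r.φ x', r.ω g⟫_ℝ ∂(κ x) = ∫ x', ⟪r.φ x', r.ω g⟫_ℝ ∂(κ x) := by
      refine setIntegral_eq_integral_of_forall_compl_eq_zero fun x' hx' => ?_
      have : x' = g := by simpa using hx'
      rw [this, inner_φ_self_ω h]
    rw [e1, e2, integral_inner_φ _ (hinteg x)]
    have e3 := inner_T_φ_ω h hx
    have e4 : ⟪r.H.orthogonalProjectionOnto (∫ x', r.ambientFeature x' ∂(κ x))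
        - r.T g (r.φ x), r.ω g⟫_ℝ =
        ⟪r.H.orthogonalProjectionOnto (∫ x', r.ambientFeature x' ∂(κ x)), r.ω g⟫_ℝ
          - (1 + ⟪r.φ x, r.ω g⟫_ℝ) := by rw [inner_sub_left, e3]
    have e5 := (abs_real_inner_le_norm (r.H.orthogonalProjectionOnto
      (∫ x', r.ambientFeature x' ∂(κ x)) - r.T g (r.φ x)) (r.ω g)).trans
        (mul_le_mul_of_nonneg_right (h.capacity x hx) (norm_nonneg _))
    rw [e4, ← abs_neg] at e5
    refine le_of_eq_of_le (congrArg _ ?_) e5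
    ring
  rw [lintegral_hittingTime κ hx]
  exact h.resolvent.2 _ hfb _ hkill ⟨x, hx⟩

end Reference

/-- The existence of an admissible reference bounds all expected hitting times, uniformly in the
goal, and so forces the state space to be finite. -/
lemma Reference.Admissible.finite {X : Type u} [MeasurableSpace X] [MeasurableSingletonClass X]
    {r : Reference.{u, w} X} {κ : Kernel X X} [IsMarkovKernel κ] {ε : ℝ} {x₀ : X} {ν : Measure X}
    (hr : r.Admissible κ ε x₀ ν) : Finite X := by
  refine finite_of_lintegral_hittingTime_le κ x₀ ((⨆ g, r.CH g) / (1 - ⨆ g, r.ρ g)) fun g => ?_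
  by_cases hg : x₀ = g
  · subst hg
    rw [lintegral_hittingTime_self]
    exact bot_le
  · rw [lintegral_hittingTime κ hg]
    refine (tsum_survival_le_of_resolventBound κ (hr.at_goal g).resolvent hg).trans
      (ENNReal.ofReal_le_ofReal ?_)
    have h1 := le_ciSup hr.bddAbove_CH g
    have h2 := le_ciSup hr.bddAbove_ρ g
    have h3 := hr.iSup_ρ_lt_one
    have h4 := (hr.at_goal g).one_le_CH
    exact div_le_div₀ (by linarith) h1 (by linarith) (by linarith)

/-- The displacement target agrees with the prediction of a reference up to twice its
benchmark. -/
lemma Reference.Admissible.abs_predictor_sub_displacementTarget_le {X : Type u}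
    [MeasurableSpace X] [MeasurableSingletonClass X] {A : Type v} [MeasurableSpace A]
    {P : Kernel (X × A) X} [IsMarkovKernel P] {π : Kernel X A} [IsMarkovKernel π]
    {r : Reference.{u, w} X} {ε : ℝ} (hε : 0 ≤ ε) {x₀ : X} {ν : Measure X}
    (hr : r.Admissible (policyKernel P π) ε x₀ ν) (s t g : X) :
    |displacementTarget P π s t g - predictor r.ω r.φ s t g| ≤ 2 * r.benchmark ε := by
  have := hr.finite
  have key : ∀ x, |(expectedHittingTime P π x g).toReal + ⟪r.φ x, r.ω g⟫_ℝ| ≤ r.benchmark ε := by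
    intro x
    have h1 := le_ciSup hr.bddAbove_CH g
    have h2 := le_ciSup hr.bddAbove_ρ g
    have h3 := hr.iSup_ρ_lt_one
    have h4 := (hr.at_goal g).one_le_CH
    have h5 := le_ciSup hr.bddAbove_ω g
    have h6 := norm_nonneg (r.ω g)
    unfold Reference.benchmark
    by_cases hx : x = g
    · subst hx
      rw [expectedHittingTime, lintegral_hittingTime_self,
        Reference.inner_φ_self_ω (hr.at_goal x)]
      simp only [ENNReal.toReal_zero, add_zero, abs_zero]
      exact div_nonneg (mul_nonneg (mul_nonneg (by linarith) (h6.trans h5)) hε) (by linarith)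
    · refine (Reference.abs_hittingTime_add_inner_le (hr.at_goal g) hr.integrable_feature x
        hx).trans ?_
      rw [div_mul_eq_mul_div, mul_comm ε, ← mul_assoc]
      have h7 : 0 ≤ ⨆ g, r.CH g := by linarith
      exact div_le_div₀ (mul_nonneg (mul_nonneg h7 (h6.trans h5)) hε)
        (mul_le_mul_of_nonneg_right (mul_le_mul h1 h5 h6 h7) hε) (by linarith) (by linarith)
  have h1 := key s
  have h2 := key t
  rw [abs_le] at h1 h2 ⊢
  unfold displacementTarget predictor
  rw [inner_sub_left]
  constructor <;> linarith

/-! ### McDiarmid's inequality -/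

section BoundedDifferences

variable {𝒯 : Type v} [MeasurableSpace 𝒯]

lemma integrable_of_abs_le {α : Type*} [MeasurableSpace α] {μ : Measure α} [IsFiniteMeasure μ]
    {f : α → ℝ} (hf : Measurable f) {M : ℝ} (hM : ∀ x, |f x| ≤ M) : Integrable f μ :=
  Integrable.of_bound hf.aestronglyMeasurable M (.of_forall hM)

lemma abs_integral_le_of_abs_le {α : Type*} [MeasurableSpace α] {μ : Measure α}
    [IsProbabilityMeasure μ] {f : α → ℝ} {M : ℝ} (hM : ∀ x, |f x| ≤ M) : |∫ x, f x ∂μ| ≤ M := by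
  simpa using norm_integral_le_of_norm_le_const (μ := μ) (f := f) (.of_forall hM)

lemma measurable_cons {n : ℕ} :
    Measurable (fun p : 𝒯 × (Fin n → 𝒯) => (Fin.cons p.1 p.2 : Fin (n + 1) → 𝒯)) := by
  refine measurable_pi_lambda _ fun i => ?_
  refine Fin.cases ?_ (fun i => ?_) i
  · simpa using measurable_fst
  · simp only [Fin.cons_succ]
    exact (measurable_pi_apply i).comp measurable_snd

lemma integral_pi_succ (Q : Measure 𝒯) [IsProbabilityMeasure Q] {n : ℕ}
    {F : (Fin (n + 1) → 𝒯) → ℝ} (hF : Measurable F) {M : ℝ} (hM : ∀ x, |F x| ≤ M) :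
    ∫ x, F x ∂(Measure.pi fun _ => Q) =
      ∫ x, ∫ y, F (Fin.cons x y) ∂(Measure.pi fun _ : Fin n => Q) ∂Q := by
  have hmp := (measurePreserving_piFinSuccAbove (fun _ : Fin (n + 1) => Q) 0).symm
  rw [← hmp.integral_comp' F, integral_prod]
  · refine integral_congr_ae (.of_forall fun x => integral_congr_ae (.of_forall fun y => ?_))
    simp [Fin.insertNthEquiv]
  · exact integrable_of_abs_le (hF.comp (MeasurableEquiv.measurable _)) fun _ => hM _

/-- The moment generating function bound behind McDiarmid's inequality. -/
lemma integral_exp_sub_integral_le (Q : Measure 𝒯) [IsProbabilityMeasure Q] {c : ℝ} (hc : 0 ≤ c)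
    (s : ℝ) {n : ℕ} {f : (Fin n → 𝒯) → ℝ} (hf : Measurable f) {M : ℝ} (hM : ∀ x, |f x| ≤ M)
    (hdiff : ∀ x j y, |f (Function.update x j y) - f x| ≤ c) :
    ∫ x, Real.exp (s * (f x - ∫ x', f x' ∂(Measure.pi fun _ => Q))) ∂(Measure.pi fun _ => Q) ≤
      Real.exp (n * (c / 2) ^ 2 * s ^ 2 / 2) := by
  induction n with
  | zero =>
    have hconst : ∀ x, f x = f default := fun x => by rw [Subsingleton.elim x default]
    simp_rw [hconst]
    simp
  | succ n ih =>
    -- Averaging out all coordinates but the first separates the deviation: slices around `h` go to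
    -- the induction hypothesis, and `h` around its mean to Hoeffding's lemma.
    set h : 𝒯 → ℝ := fun x => ∫ y, f (Fin.cons x y) ∂(Measure.pi fun _ : Fin n => Q) with hh
    have hfc : ∀ x, Measurable fun y : Fin n → 𝒯 => f (Fin.cons x y) := fun x =>
      hf.comp (measurable_cons.comp measurable_prodMk_left)
    have hhm : Measurable h :=
      (hf.comp measurable_cons).stronglyMeasurable.integral_prod_right'.measurable
    have hhM : ∀ x, |h x| ≤ M := fun x => abs_integral_le_of_abs_le fun y => hM _
    have hhdiff : ∀ x x', h x - h x' ≤ c := by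
      intro x x'
      rw [hh]
      dsimp only
      rw [← integral_sub (integrable_of_abs_le (hfc x) fun _ => hM _)
        (integrable_of_abs_le (hfc x') fun _ => hM _)]
      refine (le_abs_self _).trans (abs_integral_le_of_abs_le fun y => ?_)
      have := hdiff (Fin.cons x' y) 0 x
      rwa [Fin.update_cons_zero] at this
    have hmean : ∫ x, f x ∂(Measure.pi fun _ => Q) = ∫ x, h x ∂Q := integral_pi_succ Q hf hM
    rw [hmean]
    have hexpb : ∀ (a b : ℝ), |a| ≤ M → |b| ≤ M →
        |Real.exp (s * (a - b))| ≤ Real.exp (|s| * (2 * M)) := by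
      intro a b ha hb
      rw [abs_of_pos (Real.exp_pos _)]
      refine Real.exp_le_exp.2 ((le_abs_self _).trans ?_)
      rw [abs_mul]
      refine mul_le_mul_of_nonneg_left ((abs_sub _ _).trans ?_) (abs_nonneg _)
      linarith
    have hhint : |∫ x, h x ∂Q| ≤ M := abs_integral_le_of_abs_le hhM
    rw [integral_pi_succ Q (by fun_prop) fun x => hexpb _ _ (hM x) hhint]
    have hinner : ∀ x, ∫ y, Real.exp (s * (f (Fin.cons x y) - ∫ x, h x ∂Q))
        ∂(Measure.pi fun _ : Fin n => Q) ≤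
        Real.exp (n * (c / 2) ^ 2 * s ^ 2 / 2) * Real.exp (s * (h x - ∫ x, h x ∂Q)) := by
      intro x
      have e : ∀ y : Fin n → 𝒯, Real.exp (s * (f (Fin.cons x y) - ∫ x, h x ∂Q)) =
          Real.exp (s * (f (Fin.cons x y) - h x)) * Real.exp (s * (h x - ∫ x, h x ∂Q)) := by
        intro y
        rw [← Real.exp_add]
        congr 1
        ring
      simp_rw [e]
      rw [integral_mul_const]
      refine mul_le_mul_of_nonneg_right ?_ (Real.exp_pos _).le
      refine ih (hfc x) (fun y => hM _) fun y j z => ?_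
      have := hdiff (Fin.cons x y) j.succ z
      rwa [← Fin.cons_update] at this
    have hne : Nonempty 𝒯 := nonempty_of_isProbabilityMeasure Q
    have hbdd : BddBelow (Set.range h) := ⟨-M, by rintro _ ⟨x, rfl⟩; exact (abs_le.1 (hhM x)).1⟩
    -- An interval of length `c`, not a symmetric one of length `2 * c`, gives the sharp variance
    -- proxy `(c / 2) ^ 2`.
    have hIcc : ∀ x, h x ∈ Set.Icc (⨅ x, h x) ((⨅ x, h x) + c) := by
      refine fun x => ⟨ciInf_le hbdd x, ?_⟩
      have : h x - c ≤ ⨅ x, h x := le_ciInf fun x' => by linarith [hhdiff x x']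
      linarith
    have hoeff := (hasSubgaussianMGF_of_mem_Icc (μ := Q) hhm.aemeasurable
      (.of_forall hIcc)).mgf_le s
    have hcast : (((‖(⨅ x, h x) + c - ⨅ x, h x‖₊ / 2) ^ 2 : NNReal) : ℝ) = (c / 2) ^ 2 := by
      push_cast
      rw [add_sub_cancel_left, Real.norm_of_nonneg hc]
    rw [hcast] at hoeff
    calc _ ≤ ∫ x, Real.exp (n * (c / 2) ^ 2 * s ^ 2 / 2) *
            Real.exp (s * (h x - ∫ x, h x ∂Q)) ∂Q := by
          refine integral_mono_of_nonneg
            (.of_forall fun x => integral_nonneg fun y => (Real.exp_pos _).le) ?_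
            (.of_forall hinner)
          exact (integrable_of_abs_le (by fun_prop) fun x => hexpb _ _ (hhM x) hhint).const_mul _
      _ ≤ Real.exp (n * (c / 2) ^ 2 * s ^ 2 / 2) * Real.exp ((c / 2) ^ 2 * s ^ 2 / 2) := by
          rw [integral_const_mul]
          exact mul_le_mul_of_nonneg_left hoeff (Real.exp_pos _).le
      _ = _ := by
          rw [← Real.exp_add]
          congr 1
          push_cast
          ring

/-- **McDiarmid's inequality**. -/
lemma measure_pi_gt_integral_add_le (Q : Measure 𝒯) [IsProbabilityMeasure Q] {c : ℝ} (hc : 0 ≤ c)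
    {n : ℕ} (hn : 0 < n) {f : (Fin n → 𝒯) → ℝ} (hf : Measurable f) {M : ℝ} (hM : ∀ x, |f x| ≤ M)
    (hdiff : ∀ x j y, |f (Function.update x j y) - f x| ≤ c) {δ : ℝ} (hδ : 0 < δ) (hδ1 : δ < 1) :
    (Measure.pi fun _ => Q) {x | (∫ x', f x' ∂(Measure.pi fun _ => Q)) +
      c * n * √(Real.log (1 / δ) / (2 * n)) < f x} ≤ ENNReal.ofReal δ := by
  set μ : Measure (Fin n → 𝒯) := Measure.pi fun _ => Q
  set m := ∫ x', f x' ∂μ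
  have hm : |m| ≤ M := abs_integral_le_of_abs_le hM
  set v : ℝ := n * (c / 2) ^ 2 with hv
  have hv0 : 0 ≤ v := by positivity
  have hsub : HasSubgaussianMGF (fun x => f x - m) v.toNNReal μ := by
    refine ⟨fun s => ?_, fun s => by
      rw [Real.coe_toNNReal v hv0]; exact integral_exp_sub_integral_le Q hc s hf hM hdiff⟩
    refine integrable_of_abs_le (M := Real.exp (|s| * (2 * M))) (by fun_prop) fun x => ?_
    rw [abs_of_pos (Real.exp_pos _)]
    refine Real.exp_le_exp.2 ((le_abs_self _).trans ?_)
    rw [abs_mul]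
    refine mul_le_mul_of_nonneg_left ((abs_sub _ _).trans ?_) (abs_nonneg _)
    linarith [hM x]
  have hlog : 0 < Real.log (1 / δ) := Real.log_pos (by rw [lt_div_iff₀ hδ]; linarith)
  have hn' : (0 : ℝ) < n := by exact_mod_cast hn
  -- For `c = 0` the Chernoff exponent has denominator zero; then `f` equals its mean almost surely
  -- and the strict inequality fails.
  rcases hc.eq_or_lt with rfl | hc
  · rw [show v.toNNReal = 0 by simp [hv]] at hsub
    have := hsub.ae_eq_zero_of_hasSubgaussianMGF_zero
    refine le_of_eq_of_le (b := 0) ?_ bot_le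
    rw [← compl_mem_ae_iff]
    filter_upwards [this] with x hx
    simp only [Pi.zero_apply] at hx
    simp only [zero_mul, add_zero, Set.mem_compl_iff, Set.mem_ofPred_eq, not_lt]
    linarith
  · set ε := c * n * √(Real.log (1 / δ) / (2 * n)) with hε
    have hε0 : 0 ≤ ε := by positivity
    have h1 := hsub.measure_ge_le hε0
    have h2 : -ε ^ 2 / (2 * v) = Real.log δ := by
      rw [hv, hε, mul_pow, Real.sq_sqrt (by positivity), one_div, Real.log_inv]
      field_simp
    rw [Real.coe_toNNReal v hv0, h2, Real.exp_log hδ] at h1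
    refine (measure_mono fun x hx => ?_).trans
      ((ENNReal.le_ofReal_iff_toReal_le (measure_ne_top μ _) hδ.le).2 h1)
    simp only [Set.mem_ofPred_eq] at hx ⊢
    linarith

end BoundedDifferences

/-! ### Rademacher contraction -/

section Contraction

lemma bddAbove_range_of_abs_le {ι : Type*} {f : ι → ℝ} {M : ℝ} (h : ∀ i, |f i| ≤ M) :
    BddAbove (Set.range f) :=
  ⟨M, by rintro _ ⟨i, rfl⟩; exact (le_abs_self _).trans (h i)⟩

variable {ι : Type*} [Nonempty ι]

lemma abs_iSup_le_of_abs_le {f : ι → ℝ} {M : ℝ} (h : ∀ i, |f i| ≤ M) : |⨆ i, f i| ≤ M := by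
  obtain ⟨i₀⟩ := ‹Nonempty ι›
  rw [abs_le]
  exact ⟨(abs_le.1 (h i₀)).1.trans (le_ciSup (bddAbove_range_of_abs_le h) i₀),
    ciSup_le fun i => (abs_le.1 (h i)).2⟩

lemma abs_sign_mul (s : ℤˣ) (x : ℝ) : |((s : ℤ) : ℝ) * x| = |x| := by
  rcases Int.units_eq_one_or s with rfl | rfl <;> simp

/-- For indices `i`, `i'` the left side is at most `b i + b i' + |p i - p i'|`. According to the
sign of `p i - p i'`, this is attained on the right by `(i, i')` or by `(i', i)`. -/
lemma iSup_add_add_iSup_sub_le {b p q : ι → ℝ} {A M : ℝ} (hb : ∀ i, |b i| ≤ A)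
    (hp : ∀ i, |p i| ≤ M) (hqp : ∀ i i', |q i - q i'| ≤ |p i - p i'|) :
    (⨆ i, (b i + q i)) + (⨆ i, (b i - q i)) ≤ (⨆ i, (b i + p i)) + ⨆ i, (b i - p i) := by
  have hadd : BddAbove (Set.range fun i => b i + p i) :=
    bddAbove_range_of_abs_le fun i => (abs_add_le _ _).trans (add_le_add (hb i) (hp i))
  have hsub : BddAbove (Set.range fun i => b i - p i) :=
    bddAbove_range_of_abs_le fun i => (abs_sub _ _).trans (add_le_add (hb i) (hp i))
  rw [← le_sub_iff_add_le]
  refine ciSup_le fun i => ?_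
  rw [le_sub_comm]
  refine ciSup_le fun i' => ?_
  have h1 := le_ciSup hadd i
  have h2 := le_ciSup hsub i
  have h3 := le_ciSup hadd i'
  have h4 := le_ciSup hsub i'
  have h5 := (le_abs_self _).trans (hqp i i')
  rcases abs_cases (p i - p i') with ⟨h, -⟩ | ⟨h, -⟩ <;> linarith

/-- The contraction principle for Rademacher sums. -/
lemma sum_sign_iSup_contraction {n : ℕ} {a : ι → ℝ} {p q : ι → Fin n → ℝ} {A M : ℝ}
    (ha : ∀ i, |a i| ≤ A) (hp : ∀ i j, |p i j| ≤ M) (hq : ∀ i j, |q i j| ≤ M)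
    (hqp : ∀ i i' j, |q i j - q i' j| ≤ |p i j - p i' j|) :
    ∑ σ : Fin n → ℤˣ, ⨆ i, (a i + ∑ j, ((σ j : ℤ) : ℝ) * q i j) ≤
      ∑ σ : Fin n → ℤˣ, ⨆ i, (a i + ∑ j, ((σ j : ℤ) : ℝ) * p i j) := by
  induction n generalizing a A with
  | zero => simp
  | succ n ih =>
    have hsplit : ∀ F : (Fin (n + 1) → ℤˣ) → ℝ, ∑ σ, F σ =
        ∑ s : ℤˣ, ∑ σ : Fin n → ℤˣ, F (Fin.cons s σ) := fun F => by
      rw [← Fintype.sum_prod_type' fun (s : ℤˣ) (σ : Fin n → ℤˣ) => F (Fin.cons s σ)]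
      exact (Fintype.sum_equiv (Fin.consEquiv fun _ => ℤˣ) _ _ fun _ => rfl).symm
    rw [hsplit, hsplit]
    simp only [Fin.sum_univ_succ, Fin.cons_zero, Fin.cons_succ, ← add_assoc]
    -- The offset `a` exists for this step: it absorbs the first coordinate while the others are
    -- contracted. That coordinate is then contracted by pairing its two signs.
    have h1 : ∀ s : ℤˣ, ∑ σ : Fin n → ℤˣ, ⨆ i, (a i + ((s : ℤ) : ℝ) * q i 0 +
        ∑ j : Fin n, ((σ j : ℤ) : ℝ) * q i j.succ) ≤
        ∑ σ : Fin n → ℤˣ, ⨆ i, (a i + ((s : ℤ) : ℝ) * q i 0 +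
        ∑ j : Fin n, ((σ j : ℤ) : ℝ) * p i j.succ) := fun s =>
      ih (A := A + M) (fun i => (abs_add_le _ _).trans
        (add_le_add (ha i) ((abs_sign_mul s _).trans_le (hq i 0))))
        (fun i j => hp i j.succ) (fun i j => hq i j.succ) (fun i i' j => hqp i i' j.succ)
    refine (Finset.sum_le_sum fun s _ => h1 s).trans ?_
    rw [Finset.sum_comm, Finset.sum_comm (s := Finset.univ (α := ℤˣ))]
    refine Finset.sum_le_sum fun σ _ => ?_
    have hb : ∀ i, |a i + ∑ j : Fin n, ((σ j : ℤ) : ℝ) * p i j.succ| ≤ A + n * M := fun i => by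
      refine (abs_add_le _ _).trans (add_le_add (ha i) ((Finset.abs_sum_le_sum_abs _ _).trans ?_))
      refine (Finset.sum_le_sum fun j _ => (abs_sign_mul _ _).trans_le (hp i j.succ)).trans ?_
      simp
    have := iSup_add_add_iSup_sub_le hb (fun i => hp i 0) (fun i i' => hqp i i' 0)
    rw [UnitsInt.univ, Finset.sum_pair (by decide), Finset.sum_pair (by decide)]
    simp only [Units.val_one, Int.cast_one, one_mul, Units.val_neg, Int.cast_neg, neg_mul]
    refine le_of_eq_of_le ?_ (this.trans_eq ?_) <;>
      exact congrArg₂ _ (iSup_congr fun i => by ring) (iSup_congr fun i => by ring)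

end Contraction

/-! ### Symmetrization and uniform deviations -/

section Symmetrization

variable {𝒯 : Type v} [MeasurableSpace 𝒯] {ι : Type*} {N : ℕ}

lemma integral_pi_eval (Q : Measure 𝒯) [IsProbabilityMeasure Q] {f : 𝒯 → ℝ} (hf : Measurable f)
    (j : Fin N) : ∫ τ, f (τ j) ∂(Measure.pi fun _ : Fin N => Q) = ∫ x, f x ∂Q := by
  have h := measurePreserving_eval (fun _ : Fin N => Q) j
  conv_rhs => rw [← h.map_eq]
  rw [integral_map h.measurable.aemeasurable hf.aestronglyMeasurable]

/-- Exchange the `j`-th points of two samples at the places where the sign is `-1`. -/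
def signSwap (σ : Fin N → ℤˣ) (p : (Fin N → 𝒯) × (Fin N → 𝒯)) : (Fin N → 𝒯) × (Fin N → 𝒯) :=
  (fun j => if σ j = 1 then p.1 j else p.2 j, fun j => if σ j = 1 then p.2 j else p.1 j)

/-- Regrouped as a family of pairs, the map acts coordinatewise by the identity or by the swap, and
both preserve `Q.prod Q`. -/
lemma measurePreserving_signSwap (Q : Measure 𝒯) [IsProbabilityMeasure Q] (σ : Fin N → ℤˣ) :
    MeasurePreserving (signSwap σ)
      ((Measure.pi fun _ : Fin N => Q).prod (Measure.pi fun _ : Fin N => Q))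
      ((Measure.pi fun _ : Fin N => Q).prod (Measure.pi fun _ : Fin N => Q)) := by
  have h1 := measurePreserving_arrowProdEquivProdArrow 𝒯 𝒯 (Fin N) (fun _ => Q) (fun _ => Q)
  have h2 : MeasurePreserving
      (fun (a : Fin N → 𝒯 × 𝒯) j => (if σ j = 1 then id else Prod.swap) (a j))
      (Measure.pi fun _ : Fin N => Q.prod Q) (Measure.pi fun _ : Fin N => Q.prod Q) := by
    refine measurePreserving_pi _ _ (f := fun j => if σ j = 1 then id else Prod.swap) fun j => ?_
    split_ifs
    · exact MeasurePreserving.id _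
    · exact Measure.measurePreserving_swap
  have h3 := h1.comp (h2.comp h1.symm)
  convert h3 using 1
  ext p j
  · simp only [signSwap, Function.comp_apply]
    by_cases h : σ j = 1 <;>
      simp [h, MeasurableEquiv.arrowProdEquivProdArrow, Equiv.arrowProdEquivProdArrow]
  · simp only [signSwap, Function.comp_apply]
    by_cases h : σ j = 1 <;>
      simp [h, MeasurableEquiv.arrowProdEquivProdArrow, Equiv.arrowProdEquivProdArrow]

lemma abs_sum_sign_mul_le {q : Fin N → ℝ} {M : ℝ} (hq : ∀ j, |q j| ≤ M) (σ : Fin N → ℤˣ) :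
    |∑ j, ((σ j : ℤ) : ℝ) * q j| ≤ N * M := by
  refine (Finset.abs_sum_le_sum_abs _ _).trans ?_
  refine (Finset.sum_le_sum fun j _ => (abs_sign_mul _ _).trans_le (hq j)).trans ?_
  simp

lemma abs_sum_le {q : Fin N → ℝ} {M : ℝ} (hq : ∀ j, |q j| ≤ M) : |∑ j, q j| ≤ N * M := by
  simpa using abs_sum_sign_mul_le hq 1

variable [Countable ι] [Nonempty ι]

lemma integrable_iSup {α : Type*} [MeasurableSpace α] {μ : Measure α} [IsFiniteMeasure μ]
    {f : ι → α → ℝ} (hf : ∀ i, Measurable (f i)) {M : ℝ} (hM : ∀ i x, |f i x| ≤ M) :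
    Integrable (fun x => ⨆ i, f i x) μ :=
  integrable_of_abs_le (Measurable.iSup hf) fun x => abs_iSup_le_of_abs_le fun i => hM i x

/-- **Symmetrization** by Rademacher signs. -/
lemma integral_iSup_sum_integral_sub_le (Q : Measure 𝒯) [IsProbabilityMeasure Q] {ℓ : ι → 𝒯 → ℝ}
    (hℓ : ∀ i, Measurable (ℓ i)) {M : ℝ} (hM : ∀ i x, |ℓ i x| ≤ M) :
    ∫ τ : Fin N → 𝒯, ⨆ i, ∑ j, ((∫ x, ℓ i x ∂Q) - ℓ i (τ j)) ∂(Measure.pi fun _ => Q) ≤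
      2 * ∫ τ : Fin N → 𝒯, (1 / 2 ^ N : ℝ) * ∑ σ : Fin N → ℤˣ,
        ⨆ i, ∑ j, ((σ j : ℤ) : ℝ) * ℓ i (τ j) ∂(Measure.pi fun _ => Q) := by
  set μ : Measure (Fin N → 𝒯) := Measure.pi fun _ => Q
  have hℓj : ∀ i j, Measurable fun τ : Fin N → 𝒯 => ℓ i (τ j) := fun i j =>
    (hℓ i).comp (measurable_pi_apply j)
  have hℓ1 : ∀ i j, Measurable fun p : (Fin N → 𝒯) × (Fin N → 𝒯) => ℓ i (p.1 j) := fun i j =>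
    (hℓj i j).comp measurable_fst
  have hℓ2 : ∀ i j, Measurable fun p : (Fin N → 𝒯) × (Fin N → 𝒯) => ℓ i (p.2 j) := fun i j =>
    (hℓj i j).comp measurable_snd
  have hd : ∀ i x y, |ℓ i x - ℓ i y| ≤ M + M := fun i x y =>
    (abs_sub _ _).trans (add_le_add (hM i x) (hM i y))
  set D : (Fin N → ℤˣ) → (Fin N → 𝒯) × (Fin N → 𝒯) → ℝ := fun σ p =>
    ⨆ i, ∑ j, ((σ j : ℤ) : ℝ) * (ℓ i (p.2 j) - ℓ i (p.1 j)) with hD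
  have hDsm : ∀ (σ : Fin N → ℤˣ) i, Measurable fun p : (Fin N → 𝒯) × (Fin N → 𝒯) =>
      ∑ j, ((σ j : ℤ) : ℝ) * (ℓ i (p.2 j) - ℓ i (p.1 j)) := fun σ i =>
    Finset.measurable_sum _ fun j _ => ((hℓ2 i j).sub (hℓ1 i j)).const_mul _
  have hDsb : ∀ (σ : Fin N → ℤˣ) i (p : (Fin N → 𝒯) × (Fin N → 𝒯)),
      |∑ j, ((σ j : ℤ) : ℝ) * (ℓ i (p.2 j) - ℓ i (p.1 j))| ≤ N * (M + M) := fun σ i p =>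
    abs_sum_sign_mul_le (fun j => hd i _ _) σ
  have hDm : ∀ σ, Measurable (D σ) := fun σ => Measurable.iSup (hDsm σ)
  have hDb : ∀ σ p, |D σ p| ≤ N * (M + M) := fun σ p => abs_iSup_le_of_abs_le fun i => hDsb σ i p
  have hDint : ∀ σ, Integrable (D σ) (μ.prod μ) := fun σ => integrable_of_abs_le (hDm σ) (hDb σ)
  set R : (Fin N → ℤˣ) → ℝ := fun σ => ∫ τ, ⨆ i, ∑ j, ((σ j : ℤ) : ℝ) * ℓ i (τ j) ∂μ with hR
  have hRm : ∀ (σ : Fin N → ℤˣ) i, Measurable fun τ : Fin N → 𝒯 =>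
      ∑ j, ((σ j : ℤ) : ℝ) * ℓ i (τ j) := fun σ i =>
    Finset.measurable_sum _ fun j _ => (hℓj i j).const_mul _
  have hRb : ∀ (σ : Fin N → ℤˣ) i (τ : Fin N → 𝒯),
      |∑ j, ((σ j : ℤ) : ℝ) * ℓ i (τ j)| ≤ N * M := fun σ i τ =>
    abs_sum_sign_mul_le (fun j => hM i _) σ
  have hRint : ∀ σ : Fin N → ℤˣ,
      Integrable (fun τ : Fin N → 𝒯 => ⨆ i, ∑ j, ((σ j : ℤ) : ℝ) * ℓ i (τ j)) μ := fun σ =>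
    integrable_iSup (hRm σ) (hRb σ)
  -- Ghost sample: the mean is an integral over an independent copy, and a supremum of integrals is
  -- at most the integral of the supremum.
  have step1 : ∫ τ : Fin N → 𝒯, ⨆ i, ∑ j, ((∫ x, ℓ i x ∂Q) - ℓ i (τ j)) ∂μ ≤
      ∫ p, D 1 p ∂(μ.prod μ) := by
    rw [integral_prod _ (hDint 1)]
    refine integral_mono ?_ (hDint 1).integral_prod_left fun τ => ?_
    · refine integrable_iSup (fun i => Finset.measurable_sum _ fun j _ =>
        measurable_const.sub (hℓj i j)) (M := N * (M + M)) fun i τ => abs_sum_le fun j => ?_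
      exact (abs_sub _ _).trans (add_le_add (abs_integral_le_of_abs_le (hM i)) (hM i _))
    · refine ciSup_le fun i => ?_
      have e : ∑ j, ((∫ x, ℓ i x ∂Q) - ℓ i (τ j)) =
          ∫ τ' : Fin N → 𝒯, ∑ j, (ℓ i (τ' j) - ℓ i (τ j)) ∂μ := by
        rw [integral_finsetSum]
        · refine Finset.sum_congr rfl fun j _ => ?_
          rw [integral_sub (integrable_of_abs_le (hℓj i j) fun _ => hM i _) (integrable_const _),
            integral_pi_eval Q (hℓ i) j]
          simp
        · exact fun j _ => integrable_of_abs_le ((hℓj i j).sub measurable_const) fun _ => hd i _ _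
      rw [e]
      refine integral_mono ?_ ?_ fun τ' => ?_
      · exact integrable_of_abs_le (Finset.measurable_sum _ fun j _ =>
          (hℓj i j).sub measurable_const) fun τ' => abs_sum_le fun j => hd i _ _
      · exact integrable_of_abs_le ((hDm 1).comp measurable_prodMk_left) fun τ' => hDb 1 _
      · have := le_ciSup (bddAbove_range_of_abs_le fun i => hDsb 1 i (τ, τ')) i
        simpa [hD] using this
  have step2 : ∀ σ, ∫ p, D 1 p ∂(μ.prod μ) = ∫ p, D σ p ∂(μ.prod μ) := by
    intro σ
    have hmp := measurePreserving_signSwap Q σ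
    have e : ∫ p, D 1 (signSwap σ p) ∂(μ.prod μ) = ∫ p, D 1 p ∂(μ.prod μ) := by
      conv_rhs => rw [← hmp.map_eq]
      rw [integral_map hmp.measurable.aemeasurable (hDm 1).aestronglyMeasurable]
    rw [← e]
    refine integral_congr_ae (.of_forall fun p => iSup_congr fun i =>
      Finset.sum_congr rfl fun j _ => ?_)
    rcases Int.units_eq_one_or (σ j) with h | h <;> simp [signSwap, h]
  -- The two samples separate. Summed over all signs, `R (-σ)` contributes as much as `R σ`, whence
  -- the factor `2`.
  have step3 : ∀ σ, ∫ p, D σ p ∂(μ.prod μ) ≤ R σ + R (-σ) := by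
    intro σ
    have e1 : R σ = ∫ p : (Fin N → 𝒯) × (Fin N → 𝒯),
        ⨆ i, ∑ j, ((σ j : ℤ) : ℝ) * ℓ i (p.2 j) ∂(μ.prod μ) := by
      rw [hR]
      have := integral_fun_snd (μ := μ) (ν := μ)
        (fun τ : Fin N → 𝒯 => ⨆ i, ∑ j, ((σ j : ℤ) : ℝ) * ℓ i (τ j))
      rw [probReal_univ, one_smul] at this
      exact this.symm
    have e2 : R (-σ) = ∫ p : (Fin N → 𝒯) × (Fin N → 𝒯),
        ⨆ i, ∑ j, (((-σ) j : ℤ) : ℝ) * ℓ i (p.1 j) ∂(μ.prod μ) := by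
      rw [hR]
      have := integral_fun_fst (μ := μ) (ν := μ)
        (fun τ : Fin N → 𝒯 => ⨆ i, ∑ j, (((-σ) j : ℤ) : ℝ) * ℓ i (τ j))
      rw [probReal_univ, one_smul] at this
      exact this.symm
    have i1 : Integrable (fun p : (Fin N → 𝒯) × (Fin N → 𝒯) =>
        ⨆ i, ∑ j, ((σ j : ℤ) : ℝ) * ℓ i (p.2 j)) (μ.prod μ) :=
      integrable_iSup (fun i => (hRm σ i).comp measurable_snd) fun i p => hRb σ i p.2
    have i2 : Integrable (fun p : (Fin N → 𝒯) × (Fin N → 𝒯) =>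
        ⨆ i, ∑ j, (((-σ) j : ℤ) : ℝ) * ℓ i (p.1 j)) (μ.prod μ) :=
      integrable_iSup (fun i => (hRm (-σ) i).comp measurable_fst) fun i p => hRb (-σ) i p.1
    rw [e1, e2, ← integral_add i1 i2]
    refine integral_mono (hDint σ) (i1.add i2) fun p => ciSup_le fun i => ?_
    have h1 := le_ciSup (bddAbove_range_of_abs_le fun i => hRb σ i p.2) i
    have h2 := le_ciSup (bddAbove_range_of_abs_le fun i => hRb (-σ) i p.1) i
    refine le_of_eq_of_le ?_ (add_le_add h1 h2)
    rw [← Finset.sum_add_distrib]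
    refine Finset.sum_congr rfl fun j _ => ?_
    simp only [Pi.neg_apply, Units.val_neg, Int.cast_neg]
    ring
  have hcard : (Finset.univ : Finset (Fin N → ℤˣ)).card = 2 ^ N := by simp
  have hneg : ∑ σ, R (-σ) = ∑ σ, R σ := Fintype.sum_equiv (Equiv.neg _) _ _ fun _ => rfl
  have hsum : (2 ^ N : ℝ) * ∫ p, D 1 p ∂(μ.prod μ) ≤ 2 * ∑ σ, R σ := by
    calc (2 ^ N : ℝ) * ∫ p, D 1 p ∂(μ.prod μ)
        = ∑ σ : Fin N → ℤˣ, ∫ p, D σ p ∂(μ.prod μ) := by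
          rw [← Finset.sum_congr rfl fun σ _ => step2 σ, Finset.sum_const, hcard, nsmul_eq_mul]
          push_cast
          rfl
      _ ≤ ∑ σ, (R σ + R (-σ)) := Finset.sum_le_sum fun σ _ => step3 σ
      _ = 2 * ∑ σ, R σ := by rw [Finset.sum_add_distrib, hneg, two_mul]
  rw [integral_const_mul, integral_finsetSum _ fun σ _ => hRint σ]
  refine step1.trans ?_
  have h2N : (0 : ℝ) < 2 ^ N := by positivity
  rw [← mul_le_mul_iff_right₀ h2N]
  refine hsum.trans_eq ?_
  field_simp
  rfl

/-- The expected uniform deviation of a squared loss is controlled by the Rademacher complexity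
of the predictors. -/
lemma integral_iSup_sq_deviation_le (Q : Measure 𝒯) [IsProbabilityMeasure Q] {p : ι → 𝒯 → ℝ}
    (hp : ∀ i, Measurable (p i)) {B : ℝ} (hB : ∀ i x, |p i x| ≤ B) {y : 𝒯 → ℝ}
    (hy : Measurable y) {C : ℝ} (hC0 : 0 ≤ C) (hC : ∀ i x, |p i x - y x| ≤ C) :
    ∫ τ : Fin N → 𝒯, ⨆ i, (1 / N : ℝ) * ∑ j, ((∫ x, (p i x - y x) ^ 2 ∂Q)
        - (p i (τ j) - y (τ j)) ^ 2) ∂(Measure.pi fun _ => Q) ≤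
      4 * C * ∫ τ : Fin N → 𝒯, (1 / 2 ^ N : ℝ) * ∑ σ : Fin N → ℤˣ,
        ⨆ i, (1 / N : ℝ) * ∑ j, ((σ j : ℤ) : ℝ) * p i (τ j) ∂(Measure.pi fun _ => Q) := by
  have hN : (0 : ℝ) ≤ 1 / N := by positivity
  have hℓ : ∀ i, Measurable fun x => (p i x - y x) ^ 2 := fun i => ((hp i).sub hy).pow_const 2
  have hℓb : ∀ i x, |(p i x - y x) ^ 2| ≤ C ^ 2 := fun i x => by
    rw [abs_pow]; exact pow_le_pow_left₀ (abs_nonneg _) (hC i x) 2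
  simp_rw [← Real.mul_iSup_of_nonneg hN]
  rw [integral_const_mul]
  have hsymm := integral_iSup_sum_integral_sub_le (N := N) Q hℓ hℓb
  refine (mul_le_mul_of_nonneg_left hsymm hN).trans ?_
  have hpointwise : ∀ τ : Fin N → 𝒯, (1 / 2 ^ N : ℝ) * ∑ σ : Fin N → ℤˣ,
        ⨆ i, ∑ j, ((σ j : ℤ) : ℝ) * (p i (τ j) - y (τ j)) ^ 2 ≤
      2 * C * ((1 / 2 ^ N : ℝ) * ∑ σ : Fin N → ℤˣ, ⨆ i, ∑ j, ((σ j : ℤ) : ℝ) * p i (τ j)) := by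
    intro τ
    -- Squaring is `2 * C`-Lipschitz on residuals of size at most `C`, and in a difference of two
    -- residuals the label `y` cancels.
    have hcontr := sum_sign_iSup_contraction (n := N) (a := fun _ : ι => 0) (A := 0)
      (p := fun i j => 2 * C * p i (τ j)) (q := fun i j => (p i (τ j) - y (τ j)) ^ 2)
      (M := max (C ^ 2) (2 * C * B)) (by simp)
      (fun i j => by
        rw [abs_mul, abs_of_nonneg (by positivity : 0 ≤ 2 * C)]
        exact (mul_le_mul_of_nonneg_left (hB i _) (by positivity)).trans (le_max_right _ _))
      (fun i j => (hℓb i _).trans (le_max_left _ _))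
      (fun i i' j => by
        rw [← mul_sub, abs_mul, abs_of_nonneg (by positivity : 0 ≤ 2 * C), sq_sub_sq, abs_mul]
        have h1 := (abs_add_le _ _).trans (add_le_add (hC i (τ j)) (hC i' (τ j)))
        rw [sub_sub_sub_cancel_right]
        exact mul_le_mul_of_nonneg_right (by linarith) (abs_nonneg _))
    simp only [zero_add] at hcontr
    rw [mul_left_comm]
    refine mul_le_mul_of_nonneg_left (hcontr.trans_eq ?_) (by positivity)
    rw [Finset.mul_sum]
    refine Finset.sum_congr rfl fun σ _ => ?_
    rw [Real.mul_iSup_of_nonneg (by positivity)]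
    refine iSup_congr fun i => ?_
    rw [Finset.mul_sum]
    exact Finset.sum_congr rfl fun j _ => by ring
  have hinteg : ∀ {q : ι → 𝒯 → ℝ} (_ : ∀ i, Measurable (q i)) {M : ℝ} (_ : ∀ i x, |q i x| ≤ M),
      Integrable (fun τ : Fin N → 𝒯 => (1 / 2 ^ N : ℝ) * ∑ σ : Fin N → ℤˣ,
        ⨆ i, ∑ j, ((σ j : ℤ) : ℝ) * q i (τ j)) (Measure.pi fun _ => Q) := fun hq _ hM =>
    (integrable_finsetSum _ fun σ _ => integrable_iSup (fun i =>
      Finset.measurable_sum _ fun j _ => ((hq i).comp (measurable_pi_apply j)).const_mul _)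
        fun i τ => abs_sum_sign_mul_le (fun j => hM i (τ j)) σ).const_mul _
  have hmono := integral_mono (hinteg hℓ hℓb) ((hinteg hp hB).const_mul (2 * C)) hpointwise
  rw [integral_const_mul (2 * C)] at hmono
  have hfactor : ∀ τ : Fin N → 𝒯, (1 / 2 ^ N : ℝ) * ∑ σ : Fin N → ℤˣ,
        (1 / N : ℝ) * ⨆ i, ∑ j, ((σ j : ℤ) : ℝ) * p i (τ j) =
      (1 / N : ℝ) * ((1 / 2 ^ N : ℝ) * ∑ σ : Fin N → ℤˣ,
        ⨆ i, ∑ j, ((σ j : ℤ) : ℝ) * p i (τ j)) := fun τ => by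
    rw [← Finset.mul_sum, mul_left_comm]
  simp_rw [hfactor]
  rw [integral_const_mul (1 / N : ℝ)]
  calc _ ≤ (1 / N : ℝ) * (2 * (2 * C * _)) :=
        mul_le_mul_of_nonneg_left (mul_le_mul_of_nonneg_left hmono zero_le_two) hN
    _ = _ := by ring

/-- One-sided uniform deviation bound, relative to a fixed competitor. -/
lemma measure_pi_exists_deviation_gt_le (Q : Measure 𝒯) [IsProbabilityMeasure Q] (hN : 0 < N)
    {ℓ : ι → 𝒯 → ℝ} (hℓ : ∀ i, Measurable (ℓ i)) {ℓs : 𝒯 → ℝ} (hℓs : Measurable ℓs) {M : ℝ}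
    (hM : ∀ i x, ℓ i x ∈ Set.Icc 0 M) (hMs : ∀ x, ℓs x ∈ Set.Icc 0 M) {δ : ℝ} (hδ : 0 < δ)
    (hδ1 : δ < 1) :
    (Measure.pi fun _ : Fin N => Q) {τ | ∃ i,
      (∫ τ : Fin N → 𝒯, ⨆ i, (1 / N : ℝ) * ∑ j, ((∫ x, ℓ i x ∂Q) - ℓ i (τ j))
        ∂(Measure.pi fun _ => Q)) + 2 * M * √(Real.log (1 / δ) / (2 * N)) <
      (1 / N : ℝ) * ∑ j, ((∫ x, ℓ i x ∂Q) - ℓ i (τ j))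
        + (1 / N : ℝ) * ∑ j, (ℓs (τ j) - ∫ x, ℓs x ∂Q)} ≤ ENNReal.ofReal δ := by
  set μ : Measure (Fin N → 𝒯) := Measure.pi fun _ => Q
  have hN' : (0 : ℝ) < N := by exact_mod_cast hN
  have hN0 : (0 : ℝ) ≤ 1 / N := by positivity
  have hM0 : 0 ≤ M := by
    obtain ⟨x⟩ := nonempty_of_isProbabilityMeasure Q
    exact (hMs x).1.trans (hMs x).2
  have habs : ∀ i x, |ℓ i x| ≤ M := fun i x => by
    rw [abs_of_nonneg (hM i x).1]; exact (hM i x).2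
  have habss : ∀ x, |ℓs x| ≤ M := fun x => by rw [abs_of_nonneg (hMs x).1]; exact (hMs x).2
  set a : ι → (Fin N → 𝒯) → ℝ := fun i τ => (1 / N : ℝ) * ∑ j, ((∫ x, ℓ i x ∂Q) - ℓ i (τ j))
    with ha
  set b : (Fin N → 𝒯) → ℝ := fun τ => (1 / N : ℝ) * ∑ j, (ℓs (τ j) - ∫ x, ℓs x ∂Q) with hb
  have hmean : ∀ {q : Fin N → ℝ}, (∀ j, |q j| ≤ M + M) → |(1 / N : ℝ) * ∑ j, q j| ≤ M + M := by
    intro q hq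
    rw [abs_mul, abs_of_nonneg hN0]
    refine (mul_le_mul_of_nonneg_left (abs_sum_le hq) hN0).trans_eq ?_
    field_simp
  have hab : ∀ i τ, |a i τ| ≤ M + M := fun i τ => hmean fun j =>
    (abs_sub _ _).trans (add_le_add (abs_integral_le_of_abs_le (habs i)) (habs i _))
  have hbb : ∀ τ, |b τ| ≤ M + M := fun τ => hmean fun j =>
    (abs_sub _ _).trans (add_le_add (habss _) (abs_integral_le_of_abs_le habss))
  have ham : ∀ i, Measurable (a i) := fun i => (Finset.measurable_sum _ fun j _ =>
    measurable_const.sub ((hℓ i).comp (measurable_pi_apply j))).const_mul _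
  have hbm : Measurable b := (Finset.measurable_sum _ fun j _ =>
    (hℓs.comp (measurable_pi_apply j)).sub measurable_const).const_mul _
  have hupdate : ∀ (q : 𝒯 → ℝ) (τ : Fin N → 𝒯) (j : Fin N) (x : 𝒯),
      (∑ k, q (Function.update τ j x k)) - ∑ k, q (τ k) = q x - q (τ j) := by
    intro q τ j x
    rw [← Finset.sum_sub_distrib, Finset.sum_eq_single j]
    · simp
    · intro k _ hk
      simp [hk]
    · simp
  have hdiff_of_Icc : ∀ {s t : ℝ}, s ∈ Set.Icc 0 M → t ∈ Set.Icc 0 M → |s - t| ≤ M := by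
    rintro s t ⟨h1, h2⟩ ⟨h3, h4⟩
    rw [abs_le]
    constructor <;> linarith
  have hadiff : ∀ i τ j x, |a i (Function.update τ j x) - a i τ| ≤ M / N := by
    intro i τ j x
    have := hupdate (fun x => (∫ x, ℓ i x ∂Q) - ℓ i x) τ j x
    rw [ha]
    dsimp only
    rw [← mul_sub, this, sub_sub_sub_cancel_left, abs_mul, abs_of_nonneg hN0, one_div_mul_eq_div]
    exact div_le_div_of_nonneg_right (hdiff_of_Icc (hM i _) (hM i _)) hN'.le
  have hbdiff : ∀ τ j x, |b (Function.update τ j x) - b τ| ≤ M / N := by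
    intro τ j x
    have := hupdate (fun x => ℓs x - ∫ x, ℓs x ∂Q) τ j x
    rw [hb]
    dsimp only
    rw [← mul_sub, this, sub_sub_sub_cancel_right, abs_mul, abs_of_nonneg hN0, one_div_mul_eq_div]
    exact div_le_div_of_nonneg_right (hdiff_of_Icc (hMs _) (hMs _)) hN'.le
  have hbdd : ∀ τ, BddAbove (Set.range fun i => a i τ) := fun τ =>
    bddAbove_range_of_abs_le fun i => hab i τ
  have hsupdiff : ∀ τ τ', (∀ i, |a i τ - a i τ'| ≤ M / N) →
      (⨆ i, a i τ) - (⨆ i, a i τ') ≤ M / N := by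
    intro τ τ' h
    rw [sub_le_iff_le_add]
    refine ciSup_le fun i => ?_
    linarith [le_ciSup (hbdd τ') i, (abs_le.1 (h i)).2]
  have hℓsj : ∀ j, Measurable fun τ : Fin N → 𝒯 => ℓs (τ j) := fun j =>
    hℓs.comp (measurable_pi_apply j)
  -- The competitor is fixed, so its fluctuation is centred and adds no complexity term; it only
  -- enlarges the bounded difference.
  have hmeanb : ∫ τ, b τ ∂μ = 0 := by
    rw [hb, integral_const_mul, integral_finsetSum]
    · rw [Finset.sum_eq_zero, mul_zero]
      intro j _
      rw [integral_sub (integrable_of_abs_le (hℓsj j) fun _ => habss _)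
        (integrable_const _), integral_pi_eval Q hℓs j]
      simp
    · exact fun j _ => (integrable_of_abs_le (hℓsj j)
        fun _ => habss _).sub (integrable_const _)
  have hasup : Integrable (fun τ => ⨆ i, a i τ) μ := integrable_iSup ham hab
  -- Replacing one sample moves the supremum and the competitor term by at most `M / N` each. A
  -- single application to their sum avoids a union bound.
  have hmain := measure_pi_gt_integral_add_le Q (c := 2 * M / N) (by positivity) hN
    (f := fun τ => (⨆ i, a i τ) + b τ) ((Measurable.iSup ham).add hbm)
    (M := M + M + (M + M))
    (fun τ => (abs_add_le _ _).trans
      (add_le_add (abs_iSup_le_of_abs_le fun i => hab i τ) (hbb τ)))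
    (fun τ j x => by
      have h1 := hsupdiff (Function.update τ j x) τ fun i => hadiff i τ j x
      have h2 := hsupdiff τ (Function.update τ j x) fun i => by
        rw [abs_sub_comm]; exact hadiff i τ j x
      have h3 := abs_le.1 (hbdiff τ j x)
      have h4 : 2 * M / N = M / N + M / N := by ring
      rw [abs_le, h4]
      constructor <;> linarith [h3.1, h3.2]) hδ hδ1
  rw [integral_add hasup (integrable_of_abs_le hbm hbb), hmeanb, add_zero,
    div_mul_cancel₀ _ hN'.ne'] at hmain
  refine (measure_mono ?_).trans hmain
  rintro τ ⟨i, hi⟩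
  exact hi.trans_le (add_le_add_left (le_ciSup (hbdd τ) i) _)

end Symmetrization

/-! ### Least-squares alignment of analysis operators -/

section AnalysisOperator

variable {X : Type u} [MeasurableSpace X] {ν : Measure X}
  {E : Type w} [NormedAddCommGroup E] [InnerProductSpace ℝ E]
  {F : Type w₁} [NormedAddCommGroup F] [InnerProductSpace ℝ F]

/-- A bounded analysis operator, as a continuous linear map into `L²(ν)`. -/
lemma AnalysisBounded.exists_continuousLinearMap {D : Submodule ℝ E} {ω : X → E}
    (h : AnalysisBounded ν D ω) :
    ∃ A : D →L[ℝ] Lp ℝ 2 ν, ∀ d : D, A d =ᵐ[ν] fun x => ⟪(d : E), ω x⟫_ℝ := by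
  obtain ⟨C, hC⟩ := h
  let A : D →ₗ[ℝ] Lp ℝ 2 ν :=
    { toFun := fun d => (hC d d.2).1.toLp
      map_add' := fun d d' => by
        rw [← MemLp.toLp_add]
        exact MemLp.toLp_congr _ _ (.of_forall fun x => inner_add_left _ _ _)
      map_smul' := fun c d => by
        rw [RingHom.id_apply, ← MemLp.toLp_const_smul]
        exact MemLp.toLp_congr _ _ (.of_forall fun x => real_inner_smul_left _ _ _) }
  refine ⟨A.mkContinuous |C| fun d => ?_, fun d => (hC d d.2).1.coeFn_toLp⟩
  change ‖(hC d d.2).1.toLp‖ ≤ _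
  rw [Lp.norm_toLp]
  refine ENNReal.toReal_le_of_le_ofReal (by positivity) ((hC d d.2).2.trans ?_)
  exact ENNReal.ofReal_le_ofReal (mul_le_mul_of_nonneg_right (le_abs_self C) (norm_nonneg _))

lemma eLpNorm_eq_ofReal_norm {f : Lp ℝ 2 ν} {g : X → ℝ} (h : f =ᵐ[ν] g) :
    eLpNorm g 2 ν = ENNReal.ofReal ‖f‖ := by
  rw [← eLpNorm_congr_ae h, Lp.norm_def, ENNReal.ofReal_toReal (Lp.eLpNorm_ne_top f)]

/-- Least-squares alignment of two analysis operators: `B⁻¹ ∘ proj_{range B} ∘ A`. -/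
lemma exists_alignment {D : Submodule ℝ E} {ω : X → E} (hA : AnalysisBounded ν D ω)
    {D' : Submodule ℝ F} [FiniteDimensional ℝ D'] {ω' : X → F} (hB : AnalysisBounded ν D' ω')
    {m : ℝ} (hm : 0 < m) (hBm : AnalysisLowerBound ν D' ω' m) :
    ∃ T : D →L[ℝ] D', ∀ (d : D) (d' : D'), ENNReal.ofReal (m * ‖T d - d'‖) ≤
      eLpNorm (fun x => ⟪(d : E), ω x⟫_ℝ - ⟪(d' : F), ω' x⟫_ℝ) 2 ν := by
  obtain ⟨A, hA⟩ := hA.exists_continuousLinearMap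
  obtain ⟨B, hB⟩ := hB.exists_continuousLinearMap
  have hBlow : ∀ d, m * ‖d‖ ≤ ‖B d‖ := fun d => by
    have := hBm d d.2
    rw [eLpNorm_eq_ofReal_norm (hB d)] at this
    exact (ENNReal.ofReal_le_ofReal_iff (norm_nonneg _)).1 this
  have hinj : Function.Injective (B : D' →ₗ[ℝ] Lp ℝ 2 ν) := by
    refine (injective_iff_map_eq_zero _).2 fun d hd => ?_
    have := hBlow d
    rw [show B d = 0 from hd, norm_zero] at this
    exact norm_le_zero_iff.1 (by nlinarith [norm_nonneg d])
  set K := LinearMap.range (B : D' →ₗ[ℝ] Lp ℝ 2 ν)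
  obtain ⟨e, he⟩ : ∃ e : D' ≃ₗ[ℝ] K, ∀ d, (e d : Lp ℝ 2 ν) = B d :=
    ⟨LinearEquiv.ofInjective (B : D' →ₗ[ℝ] Lp ℝ 2 ν) hinj, fun _ => rfl⟩
  let T : D →L[ℝ] D' := (LinearMap.toContinuousLinearMap (e.symm : K →ₗ[ℝ] D')) ∘L
    K.orthogonalProjectionOnto ∘L A
  have hBT : ∀ d, B (T d) = K.orthogonalProjectionOnto (A d) := fun d => by
    have h := congrArg Subtype.val (e.apply_symm_apply (K.orthogonalProjectionOnto (A d)))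
    rwa [he] at h
  refine ⟨T, fun d d' => ?_⟩
  have hae : (A d - B d' : Lp ℝ 2 ν) =ᵐ[ν] fun x => ⟪(d : E), ω x⟫_ℝ - ⟪(d' : F), ω' x⟫_ℝ := by
    filter_upwards [Lp.coeFn_sub (A d) (B d'), hA d, hB d'] with x h1 h2 h3
    rw [h1, Pi.sub_apply, h2, h3]
  rw [eLpNorm_eq_ofReal_norm hae]
  refine ENNReal.ofReal_le_ofReal ((hBlow _).trans ?_)
  -- Hence `B (T d) - B d'` is the projection of `A d - B d'`, whose norm can only be smaller.
  have hfix : (K.orthogonalProjectionOnto (B d') : Lp ℝ 2 ν) = B d' :=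
    Submodule.starProjection_eq_self_iff.2 ⟨d', rfl⟩
  rw [map_sub, hBT, ← hfix, ← Submodule.coe_sub, ← map_sub, hfix]
  exact K.norm_orthogonalProjectionOnto_apply_le _

end AnalysisOperator

/-! ### The tuple law and the bias-noise decomposition -/

section Tuples

variable {X : Type u} [MeasurableSpace X] {𝒯 : Type v} [MeasurableSpace 𝒯]

lemma isProbabilityMeasure_tupleLaw (Q : Measure 𝒯) [IsProbabilityMeasure Q] {m : ℕ} (hm : 0 < m)
    {z : Fin m → 𝒯 → DataTuple X} (hz : ∀ t, Measurable (z t)) :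
    IsProbabilityMeasure (tupleLaw Q z) := by
  constructor
  have h : ∀ t, (Q.map (z t)) Set.univ = 1 := fun t => by
    rw [Measure.map_apply (hz t) .univ, Set.preimage_univ, measure_univ]
  simp only [tupleLaw, Measure.smul_apply, Measure.finsetSum_apply, h, smul_eq_mul]
  simp only [Finset.sum_const, Finset.card_univ, Fintype.card_fin, nsmul_eq_mul, mul_one]
  exact ENNReal.inv_mul_cancel (by exact_mod_cast hm.ne') (ENNReal.natCast_ne_top m)

lemma ae_tupleLaw {Q : Measure 𝒯} {m : ℕ} {z : Fin m → 𝒯 → DataTuple X}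
    (hz : ∀ t, Measurable (z t)) {p : DataTuple X → Prop} (hp : MeasurableSet {y | p y})
    (h : ∀ t, ∀ᵐ τ ∂Q, p (z t τ)) : ∀ᵐ y ∂(tupleLaw Q z), p y := by
  refine Measure.ae_smul_measure ?_ _
  rw [ae_iff, Measure.finsetSum_apply]
  exact Finset.sum_eq_zero fun t _ => (ae_map_iff (hz t).aemeasurable hp).2 (h t)

lemma integral_tupleLaw {Q : Measure 𝒯} [IsFiniteMeasure Q] {m : ℕ}
    {z : Fin m → 𝒯 → DataTuple X} (hz : ∀ t, Measurable (z t)) {f : DataTuple X → ℝ}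
    (hf : Measurable f) (hinteg : ∀ t, Integrable (fun τ => f (z t τ)) Q) :
    ∫ y, f y ∂(tupleLaw Q z) = (1 / m : ℝ) * ∑ t, ∫ τ, f (z t τ) ∂Q := by
  rw [tupleLaw, integral_smul_measure, integral_finsetSum_measure]
  · simp only [ENNReal.toReal_inv, ENNReal.toReal_natCast, smul_eq_mul, one_div]
    congr 1
    exact Finset.sum_congr rfl fun t _ =>
      integral_map (hz t).aemeasurable hf.aestronglyMeasurable
  · exact fun t _ => (integrable_map_measure hf.aestronglyMeasurable (hz t).aemeasurable).2
      (hinteg t)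

/-- Bias-noise decomposition of the squared loss. -/
lemma integral_sq_sub_eq_add_condExp {Ω : Type*} {𝓕 m₀ : MeasurableSpace Ω} (hle : 𝓕 ≤ m₀)
    {μ : Measure Ω} [IsFiniteMeasure μ] {F H : Ω → ℝ} (hF : MemLp F 2 μ) (hH : MemLp H 2 μ)
    (hF𝓕 : StronglyMeasurable[𝓕] F) :
    ∫ y, (F y - H y) ^ 2 ∂μ = (∫ y, (F y - (μ[H | 𝓕]) y) ^ 2 ∂μ) +
        ∫ y, ((μ[H | 𝓕]) y - H y) ^ 2 ∂μ := by
  set L : Ω → ℝ := μ[H | 𝓕] with hLdef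
  have hL : MemLp L 2 μ := hH.condExp (by norm_num)
  have hFL : StronglyMeasurable[𝓕] (F - L) := hF𝓕.sub stronglyMeasurable_condExp
  have hFLH : Integrable ((F - L) * H) μ := (hF.sub hL).integrable_mul hH
  have hFLL : Integrable ((F - L) * L) μ := (hF.sub hL).integrable_mul hL
  -- The factor `F - L` is `𝓕`-measurable, so conditioning replaces `H` by `L` and the cross term
  -- vanishes.
  have hcross : ∫ y, ((F - L) * H) y ∂μ = ∫ y, ((F - L) * L) y ∂μ := by
    rw [← integral_condExp hle]
    exact integral_congr_ae (condExp_mul_of_stronglyMeasurable_left hFL hFLH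
      (hH.integrable (by norm_num)))
  have e : ∀ y, (F y - H y) ^ 2 = ((F y - L y) ^ 2 + (L y - H y) ^ 2) +
      (2 * ((F - L) * L) y - 2 * ((F - L) * H) y) := fun y => by
    simp only [Pi.mul_apply, Pi.sub_apply]
    ring
  have i1 : Integrable (fun y => (F y - L y) ^ 2) μ := (hF.sub hL).integrable_sq
  have i2 : Integrable (fun y => (L y - H y) ^ 2) μ := (hL.sub hH).integrable_sq
  have i3 : Integrable (fun y => (F y - L y) ^ 2 + (L y - H y) ^ 2) μ := i1.add i2
  have i4 : Integrable (fun y => 2 * ((F - L) * L) y - 2 * ((F - L) * H) y) μ :=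
    (hFLL.const_mul 2).sub (hFLH.const_mul 2)
  simp_rw [e]
  rw [integral_add i3 i4, integral_add i1 i2,
    integral_sub (hFLL.const_mul 2) (hFLH.const_mul 2), integral_const_mul, integral_const_mul,
    hcross]
  ring

lemma measurable_stateGoal :
    Measurable fun y : DataTuple X => (y.1, y.2.1, y.2.2.1) :=
  measurable_fst.prodMk ((measurable_fst.comp measurable_snd).prodMk
    (measurable_fst.comp (measurable_snd.comp measurable_snd)))

lemma measurable_label : Measurable fun y : DataTuple X => y.2.2.2 :=
  measurable_snd.comp (measurable_snd.comp measurable_snd)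

lemma integral_sq_sub_label (μ : Measure (DataTuple X)) [IsFiniteMeasure μ]
    (hH : MemLp (fun y : DataTuple X => y.2.2.2) 2 μ) {f : X × X × X → ℝ} (hf : Measurable f)
    (hf2 : MemLp (fun y : DataTuple X => f (y.1, y.2.1, y.2.2.1)) 2 μ) :
    ∫ y, (f (y.1, y.2.1, y.2.2.1) - y.2.2.2) ^ 2 ∂μ =
      (∫ y, (f (y.1, y.2.1, y.2.2.1) - labelMean μ y) ^ 2 ∂μ) +
        ∫ y, (labelMean μ y - y.2.2.2) ^ 2 ∂μ :=
  integral_sq_sub_eq_add_condExp measurable_stateGoal.comap_le hf2 hH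
    (hf.comp (comap_measurable _)).stronglyMeasurable

end Tuples

/-! ### Excess risk of empirical minimizers -/

section ExcessRisk

variable {X : Type u} [MeasurableSpace X] [MeasurableSingletonClass X] [Finite X]
  {𝒯 : Type v} [MeasurableSpace 𝒯] {E : Type w} [NormedAddCommGroup E] [InnerProductSpace ℝ E]

lemma abs_predictor_le {X : Type u} {φ ω : X → E} {Cφ Cω : ℝ} (hφ : ∀ x, ‖φ x‖ ≤ Cφ)
    (hω : ∀ g, ‖ω g‖ ≤ Cω) (s t g : X) : |predictor ω φ s t g| ≤ 2 * Cφ * Cω := by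
  refine (abs_real_inner_le_norm _ _).trans ?_
  have h1 : ‖φ t - φ s‖ ≤ 2 * Cφ := (norm_sub_le _ _).trans (by linarith [hφ t, hφ s])
  exact mul_le_mul h1 (hω g) (norm_nonneg _) ((norm_nonneg _).trans h1)

/-- The predictor of an encoder, as a function of the triple `(s, u, g)`. -/
noncomputable def tripleMap (ω φ : X → E) (x : X × X × X) : ℝ := predictor ω φ x.1 x.2.1 x.2.2

/-- The triple `(s, u, g)` of a tuple. -/
def triple {X : Type u} (y : DataTuple X) : X × X × X := (y.1, y.2.1, y.2.2.1)

/-- The index set may be uncountable: the supremum is still measurable, since it factors through the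
finite set `Fin N → Y`. -/
lemma integrable_average_iSup_sign {Y α : Type*} [Finite Y] [MeasurableSpace Y]
    [MeasurableSingletonClass Y] [MeasurableSpace α] {μ : Measure α} [IsFiniteMeasure μ] {N : ℕ}
    {W : α → Fin N → Y} (hW : Measurable W) {κ : Type*} [Nonempty κ] {q : κ → Y → ℝ} {B : ℝ}
    (hq : ∀ k x, |q k x| ≤ B) :
    Integrable (fun τ => (1 / 2 ^ N : ℝ) * ∑ σ : Fin N → ℤˣ,
      ⨆ k, (1 / N : ℝ) * ∑ j, ((σ j : ℤ) : ℝ) * q k (W τ j)) μ := by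
  have hN : (0 : ℝ) ≤ 1 / N := by positivity
  refine (integrable_finsetSum _ fun σ _ => ?_).const_mul _
  have hm : Measurable fun w : Fin N → Y =>
      ⨆ k, (1 / N : ℝ) * ∑ j, ((σ j : ℤ) : ℝ) * q k (w j) := measurable_of_finite _
  refine integrable_of_abs_le (hm.comp hW) (M := 1 / N * (N * B)) fun τ =>
    abs_iSup_le_of_abs_le fun k => ?_
  rw [abs_mul, abs_of_nonneg hN]
  exact mul_le_mul_of_nonneg_left (abs_sum_sign_mul_le (fun j => hq k _) σ) hN

/-- The Rademacher complexity of a slot dominates that of a countable class of predictors of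
encoders, and the latter is nonnegative. -/
lemma rademacher_slotClass_ge (Q : Measure 𝒯) [IsProbabilityMeasure Q] (N : ℕ) {m : ℕ}
    {z : Fin m → 𝒯 → DataTuple X} (hz : ∀ t, Measurable (z t)) {ω : X → E} {Φ : Set (X → E)}
    {B : ℝ} (hB : ∀ φ ∈ Φ, ∀ x, |tripleMap ω φ x| ≤ B) {ι : Type*} [Countable ι] [Nonempty ι]
    {p : ι → X × X × X → ℝ} (hp : ∀ i, ∃ φ ∈ Φ, p i = tripleMap ω φ) (t : Fin m) :
    0 ≤ (∫ τ : Fin N → 𝒯, (1 / 2 ^ N : ℝ) * ∑ σ : Fin N → ℤˣ,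
        ⨆ i, (1 / N : ℝ) * ∑ j, ((σ j : ℤ) : ℝ) * p i (triple (z t (τ j)))
          ∂(Measure.pi fun _ => Q)) ∧
    (∫ τ : Fin N → 𝒯, (1 / 2 ^ N : ℝ) * ∑ σ : Fin N → ℤˣ,
        ⨆ i, (1 / N : ℝ) * ∑ j, ((σ j : ℤ) : ℝ) * p i (triple (z t (τ j)))
          ∂(Measure.pi fun _ => Q)) ≤ rademacher Q N (slotClass z ω Φ t) := by
  have hN : (0 : ℝ) ≤ 1 / N := by positivity
  have hpB : ∀ i x, |p i x| ≤ B := fun i x => by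
    obtain ⟨φ, hφ, h⟩ := hp i
    rw [h]; exact hB φ hφ x
  have hne : Nonempty Φ := by
    obtain ⟨φ, hφ, -⟩ := hp (Classical.arbitrary ι)
    exact ⟨⟨φ, hφ⟩⟩
  set W : (Fin N → 𝒯) → (Fin N → X × X × X) := fun τ j => triple (z t (τ j)) with hW
  have hWm : Measurable W := measurable_pi_lambda _ fun j =>
    measurable_stateGoal.comp ((hz t).comp (measurable_pi_apply j))
  have hslot : ∀ (σ : Fin N → ℤˣ) (τ : Fin N → 𝒯),
      (⨆ q : slotClass z ω Φ t, (1 / N : ℝ) * ∑ j, ((σ j : ℤ) : ℝ) * q.1 (τ j)) =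
        ⨆ φ : Φ, (1 / N : ℝ) * ∑ j, ((σ j : ℤ) : ℝ) * tripleMap ω φ (W τ j) := fun σ τ =>
    (Function.Surjective.iSup_comp (Set.imageFactorization_surjective
      (f := fun (φ : X → E) τ => predictor ω φ (z t τ).1 (z t τ).2.1 (z t τ).2.2.1) (s := Φ))
      (fun q : slotClass z ω Φ t => (1 / N : ℝ) * ∑ j, ((σ j : ℤ) : ℝ) * q.1 (τ j))).symm
  unfold rademacher
  simp_rw [hslot]
  refine ⟨integral_nonneg fun τ => mul_nonneg (by positivity) ?_, ?_⟩
  · simp_rw [← Real.mul_iSup_of_nonneg hN]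
    rw [← Finset.mul_sum]
    refine mul_nonneg hN ?_
    -- Contraction to the zero class gives nonnegativity.
    have := sum_sign_iSup_contraction (n := N) (a := fun _ : ι => 0) (A := 0) (q := fun _ _ => 0)
      (p := fun i j => p i (W τ j)) (M := B) (by simp) (fun i j => hpB i _)
      (fun i j => by simpa using (abs_nonneg _).trans (hpB i (W τ j))) (by simp)
    simpa using this
  · refine integral_mono (integrable_average_iSup_sign hWm hpB)
      (integrable_average_iSup_sign hWm (q := fun φ : Φ => tripleMap ω φ) fun φ => hB φ φ.2)
      fun τ => ?_
    refine mul_le_mul_of_nonneg_left (Finset.sum_le_sum fun σ _ => ciSup_le fun i => ?_)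
      (by positivity)
    obtain ⟨φ, hφ, h⟩ := hp i
    have hbdd : BddAbove (Set.range fun φ : Φ =>
        (1 / N : ℝ) * ∑ j, ((σ j : ℤ) : ℝ) * tripleMap ω φ (W τ j)) := by
      refine bddAbove_range_of_abs_le (M := 1 / N * (N * B)) fun φ => ?_
      rw [abs_mul, abs_of_nonneg hN]
      exact mul_le_mul_of_nonneg_left (abs_sum_sign_mul_le (fun j => hB φ φ.2 _) σ) hN
    refine le_of_eq_of_le ?_ (le_ciSup hbdd ⟨φ, hφ⟩)
    rw [h]

/-- With high probability, every encoder whose empirical risk does not exceed that of a fixed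
competitor has excess risk at most the statistical error. -/
lemma measure_pi_excess_risk_gt_le (Q : Measure 𝒯) [IsProbabilityMeasure Q] {N : ℕ} (hN : 0 < N)
    {m : ℕ} (hm : 0 < m) {z : Fin m → 𝒯 → DataTuple X} (hz : ∀ t, Measurable (z t))
    {ω : X → E} {Φ : Set (X → E)} {Cφ Cω Hmax : ℝ} (hCφ : ∀ φ ∈ Φ, ∀ x, ‖φ x‖ ≤ Cφ)
    (hCω : ∀ g, ‖ω g‖ ≤ Cω)
    (hlabel : ∀ t, ∀ᵐ τ ∂Q, 0 ≤ (z t τ).2.2.2 ∧ (z t τ).2.2.2 ≤ Hmax)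
    {δ : ℝ} (hδ : 0 < δ) (hδ1 : δ < 1) {φs : X → E} (hφs : φs ∈ Φ) :
    (Measure.pi fun _ : Fin N => Q) {τ | ∃ φ ∈ Φ,
      empiricalRisk z ω τ φ ≤ empiricalRisk z ω τ φs ∧
      (∫ y, (predictor ω φs y.1 y.2.1 y.2.2.1 - y.2.2.2) ^ 2 ∂(tupleLaw Q z)) +
          statisticalError Q N z ω Φ Cφ Cω Hmax δ <
        ∫ y, (predictor ω φ y.1 y.2.1 y.2.2.1 - y.2.2.2) ^ 2 ∂(tupleLaw Q z)} ≤
      ENNReal.ofReal δ := by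
  have hN' : (0 : ℝ) < N := by exact_mod_cast hN
  have hm' : (0 : ℝ) < m := by exact_mod_cast hm
  set B := 2 * Cφ * Cω with hBdef
  have hB : ∀ φ ∈ Φ, ∀ x, |tripleMap ω φ x| ≤ B := fun φ hφ x =>
    abs_predictor_le (hCφ φ hφ) hCω _ _ _
  obtain ⟨τ₀, hτ₀⟩ := (hlabel ⟨0, hm⟩).exists
  have hHmax : 0 ≤ Hmax := hτ₀.1.trans hτ₀.2
  have hB0 : 0 ≤ B := (abs_nonneg _).trans (hB φs hφs (triple (z ⟨0, hm⟩ τ₀)))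
  set C := B + Hmax with hC
  have hC0 : 0 ≤ C := add_nonneg hB0 hHmax
  -- clipped labels and the induced losses
  set y : Fin m → 𝒯 → ℝ := fun t τ => max 0 (min (z t τ).2.2.2 Hmax) with hy
  have hym : ∀ t, Measurable (y t) := fun t =>
    measurable_const.max ((measurable_label.comp (hz t)).min measurable_const)
  have hy0 : ∀ t τ, 0 ≤ y t τ := fun t τ => le_max_left _ _
  have hyH : ∀ t τ, y t τ ≤ Hmax := fun t τ => max_le hHmax (min_le_right _ _)
  have hyae : ∀ t, ∀ᵐ τ ∂Q, y t τ = (z t τ).2.2.2 := fun t => by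
    filter_upwards [hlabel t] with τ h
    simp [hy, h.1, h.2]
  set F : Set (X × X × X → ℝ) := tripleMap ω '' Φ with hF
  have hFB : ∀ v : F, ∀ x, |v.1 x| ≤ B := by
    rintro ⟨_, φ, hφ, rfl⟩ x
    exact hB φ hφ x
  have hFne : Nonempty F := ⟨⟨_, φs, hφs, rfl⟩⟩
  have hzm : ∀ t, Measurable fun τ => triple (z t τ) := fun t => measurable_stateGoal.comp (hz t)
  have hpm : ∀ (v : X × X × X → ℝ) t, Measurable fun τ => v (triple (z t τ)) := fun v t =>
    (measurable_of_finite v).comp (hzm t)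
  have hpy : ∀ (v : F) t τ, |v.1 (triple (z t τ)) - y t τ| ≤ C := fun v t τ => by
    refine (abs_sub _ _).trans (add_le_add (hFB v _) ?_)
    rw [abs_of_nonneg (hy0 t τ)]
    exact hyH t τ
  set q : (X × X × X → ℝ) → Fin m → 𝒯 → ℝ := fun v t τ => (v (triple (z t τ)) - y t τ) ^ 2 with hq
  have hqm : ∀ v t, Measurable (q v t) := fun v t => ((hpm v t).sub (hym t)).pow_const 2
  have hq0 : ∀ v t τ, 0 ≤ q v t τ := fun v t τ => sq_nonneg _
  have hqC : ∀ (v : F) t τ, q v t τ ≤ C ^ 2 := fun v t τ =>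
    sq_le_sq.2 ((hpy v t τ).trans (le_abs_self C))
  have hqabs : ∀ (v : F) t τ, |q v t τ| ≤ C ^ 2 := fun v t τ => by
    rw [abs_of_nonneg (hq0 _ _ _)]; exact hqC v t τ
  have hqint : ∀ (v : F) t, Integrable (q v t) Q := fun v t =>
    integrable_of_abs_le (hqm v t) (hqabs v t)
  set ℓ : (X × X × X → ℝ) → 𝒯 → ℝ := fun v τ => (1 / m : ℝ) * ∑ t, q v t τ with hℓ
  have hℓm : ∀ v, Measurable (ℓ v) := fun v =>
    (Finset.measurable_sum _ fun t _ => hqm v t).const_mul _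
  have hℓC : ∀ (v : F) τ, ℓ v τ ∈ Set.Icc 0 (C ^ 2) := by
    refine fun v τ => ⟨mul_nonneg (by positivity) (Finset.sum_nonneg fun t _ => hq0 _ _ _), ?_⟩
    calc (1 / m : ℝ) * ∑ t, q v t τ ≤ (1 / m : ℝ) * ∑ _t : Fin m, C ^ 2 :=
          mul_le_mul_of_nonneg_left (Finset.sum_le_sum fun t _ => hqC v t τ) (by positivity)
      _ = C ^ 2 := by simp [hm'.ne']
  have hℓint : ∀ v : F, ∫ τ, ℓ v τ ∂Q = (1 / m : ℝ) * ∑ t, ∫ τ, q v t τ ∂Q := fun v => by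
    rw [hℓ, integral_const_mul, integral_finsetSum _ fun t _ => hqint v t]
  -- a countable dense subclass
  obtain ⟨s, hsc, hsd⟩ := TopologicalSpace.exists_countable_dense F
  have hscount : Countable s := hsc.to_subtype
  have hsne : Nonempty s := hsd.nonempty.to_subtype
  -- The loss is averaged over the slots of one trajectory, so the samples are independent
  -- trajectories and dependence between tuples of the same trajectory is harmless.
  have hdev := measure_pi_exists_deviation_gt_le Q hN (ι := s) (ℓ := fun i => ℓ i.1.1)
    (fun i => hℓm _) (hℓm (tripleMap ω φs)) (fun i => hℓC i.1)
    (hℓC ⟨_, φs, hφs, rfl⟩) hδ hδ1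
  have hexp : ∫ τ : Fin N → 𝒯, ⨆ i : s, (1 / N : ℝ) * ∑ j, ((∫ x, ℓ i.1.1 x ∂Q) - ℓ i.1.1 (τ j))
      ∂(Measure.pi fun _ => Q) ≤ 16 * C * averageRademacher Q N z ω Φ := by
    have hNn : (0 : ℝ) ≤ 1 / N := by positivity
    have hrad := fun t => rademacher_slotClass_ge Q N hz hB (ι := s) (p := fun i => i.1.1)
      (fun i => by obtain ⟨φ, hφ, h⟩ := i.1.2; exact ⟨φ, hφ, h.symm⟩) t
    have hslot := fun t => integral_iSup_sq_deviation_le (N := N) Q (ι := s)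
      (p := fun i τ => i.1.1 (triple (z t τ))) (fun i => hpm _ t) (fun i x => hFB i.1 _) (hym t)
      hC0 (fun i τ => hpy i.1 t τ)
    have hdev_abs : ∀ (i : s) t (τ : Fin N → 𝒯),
        |(1 / N : ℝ) * ∑ j, ((∫ x, q i.1.1 t x ∂Q) - q i.1.1 t (τ j))| ≤
          1 / N * (N * (C ^ 2 + C ^ 2)) := fun i t τ => by
      rw [abs_mul, abs_of_nonneg hNn]
      refine mul_le_mul_of_nonneg_left (abs_sum_le fun j => ?_) hNn
      exact (abs_sub _ _).trans (add_le_add (abs_integral_le_of_abs_le (hqabs i.1 t))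
        (hqabs i.1 t _))
    have hdev_int : ∀ t, Integrable (fun τ : Fin N → 𝒯 => ⨆ i : s, (1 / N : ℝ) *
        ∑ j, ((∫ x, q i.1.1 t x ∂Q) - q i.1.1 t (τ j))) (Measure.pi fun _ => Q) := fun t =>
      integrable_iSup (fun i => (Finset.measurable_sum _ fun j _ => measurable_const.sub
        ((hqm i.1.1 t).comp (measurable_pi_apply j))).const_mul _) fun i τ => hdev_abs i t τ
    have hsplit : ∀ (i : s) (τ : Fin N → 𝒯),
        (1 / N : ℝ) * ∑ j, ((∫ x, ℓ i.1.1 x ∂Q) - ℓ i.1.1 (τ j)) =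
        (1 / m : ℝ) * ∑ t, (1 / N : ℝ) * ∑ j, ((∫ x, q i.1.1 t x ∂Q) - q i.1.1 t (τ j)) := by
      intro i τ
      rw [← Finset.mul_sum, Finset.sum_comm, mul_left_comm]
      congr 1
      rw [Finset.mul_sum]
      refine Finset.sum_congr rfl fun j _ => ?_
      rw [hℓint, Finset.sum_sub_distrib, mul_sub]
    calc _ ≤ ∫ τ : Fin N → 𝒯, (1 / m : ℝ) * ∑ t, ⨆ i : s, (1 / N : ℝ) *
            ∑ j, ((∫ x, q i.1.1 t x ∂Q) - q i.1.1 t (τ j)) ∂(Measure.pi fun _ => Q) := by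
          refine integral_mono ?_ ((integrable_finsetSum _ fun t _ => hdev_int t).const_mul _)
            fun τ => ?_
          · refine integrable_iSup (M := C ^ 2 + C ^ 2) (fun i => (Finset.measurable_sum _
              fun j _ => measurable_const.sub ((hℓm i.1.1).comp
                (measurable_pi_apply j))).const_mul _) fun i τ => ?_
            have habs : ∀ τ, |ℓ i.1.1 τ| ≤ C ^ 2 := fun τ => by
              rw [abs_of_nonneg (hℓC i.1 τ).1]; exact (hℓC i.1 τ).2
            rw [abs_mul, abs_of_nonneg hNn]
            refine (mul_le_mul_of_nonneg_left (abs_sum_le fun j => (abs_sub _ _).trans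
              (add_le_add (abs_integral_le_of_abs_le habs) (habs _))) hNn).trans_eq ?_
            field_simp
          · refine ciSup_le fun i => ?_
            rw [hsplit]
            exact mul_le_mul_of_nonneg_left (Finset.sum_le_sum fun t _ =>
              le_ciSup (bddAbove_range_of_abs_le fun i => hdev_abs i t τ) i) (by positivity)
      _ = (1 / m : ℝ) * ∑ t, ∫ τ : Fin N → 𝒯, ⨆ i : s, (1 / N : ℝ) *
            ∑ j, ((∫ x, q i.1.1 t x ∂Q) - q i.1.1 t (τ j)) ∂(Measure.pi fun _ => Q) := by
          rw [integral_const_mul, integral_finsetSum _ fun t _ => hdev_int t]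
      _ ≤ (1 / m : ℝ) * ∑ t, 16 * C * rademacher Q N (slotClass z ω Φ t) := by
          refine mul_le_mul_of_nonneg_left (Finset.sum_le_sum fun t _ => ?_) (by positivity)
          -- The argument gives the constant `4`; passing to `16` uses that the complexity is
          -- nonnegative.
          refine (hslot t).trans ((mul_le_mul_of_nonneg_left (hrad t).2 (by positivity)).trans ?_)
          exact mul_le_mul_of_nonneg_right (by linarith) ((hrad t).1.trans (hrad t).2)
      _ = 16 * C * averageRademacher Q N z ω Φ := by
          rw [averageRademacher, ← Finset.mul_sum]
          ring
  -- continuity of the risks in the predictor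
  have hcont : ∀ τ : Fin N → 𝒯, Continuous fun v : F =>
      (1 / N : ℝ) * ∑ j, ((∫ x, ℓ v x ∂Q) - ℓ v (τ j)) := by
    have hc1 : ∀ x, Continuous fun v : F => ℓ v x := fun x => by
      refine continuous_const.mul (continuous_finsetSum _ fun t _ => ?_)
      exact (((continuous_apply (triple (z t x))).comp continuous_subtype_val).sub
        continuous_const).pow 2
    have hc2 : Continuous fun v : F => ∫ x, ℓ v x ∂Q := by
      refine continuous_of_dominated (bound := fun _ => C ^ 2)
        (fun v => (hℓm v).aestronglyMeasurable) (fun v => .of_forall fun x => ?_)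
        (integrable_const _) (.of_forall hc1)
      rw [Real.norm_of_nonneg (hℓC v x).1]
      exact (hℓC v x).2
    exact fun τ => continuous_const.mul (continuous_finsetSum _ fun j _ => hc2.sub (hc1 _))
  -- risks in terms of the clipped losses
  have hrisk : ∀ φ ∈ Φ, ∫ y, (predictor ω φ y.1 y.2.1 y.2.2.1 - y.2.2.2) ^ 2 ∂(tupleLaw Q z) =
      ∫ τ, ℓ (tripleMap ω φ) τ ∂Q := by
    intro φ hφ
    have hae : ∀ t, q (tripleMap ω φ) t =ᵐ[Q] fun τ =>
        (tripleMap ω φ (triple (z t τ)) - (z t τ).2.2.2) ^ 2 := fun t => by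
      filter_upwards [hyae t] with τ h
      simp only [hq, h]
    rw [hℓint ⟨_, φ, hφ, rfl⟩]
    refine (integral_tupleLaw (f := fun y => (tripleMap ω φ (triple y) - y.2.2.2) ^ 2) hz ?_
      fun t => (hqint ⟨_, φ, hφ, rfl⟩ t).congr (hae t)).trans ?_
    · exact (((measurable_of_finite (tripleMap ω φ)).comp measurable_stateGoal).sub
        measurable_label).pow_const 2
    · congr 1
      exact Finset.sum_congr rfl fun t _ => integral_congr_ae (hae t).symm
  have hemp : ∀ τ : Fin N → 𝒯, (∀ j t, y t (τ j) = (z t (τ j)).2.2.2) → ∀ φ,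
      empiricalRisk z ω τ φ = (1 / N : ℝ) * ∑ j, ℓ (tripleMap ω φ) (τ j) := by
    intro τ hτ φ
    simp only [empiricalRisk, hℓ, hq, hτ]
    rw [← Finset.mul_sum, ← mul_assoc, one_div_mul_one_div]
    rfl
  have hgood : ∀ᵐ τ ∂(Measure.pi fun _ : Fin N => Q), ∀ j t, y t (τ j) = (z t (τ j)).2.2.2 := by
    refine ae_all_iff.2 fun j => ae_all_iff.2 fun t => ?_
    exact (measurePreserving_eval (fun _ : Fin N => Q) j).quasiMeasurePreserving.ae (hyae t)
  refine (measure_mono_ae ?_).trans hdev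
  filter_upwards [hgood] with τ hτ
  rintro ⟨φ, hφ, hle, hlt⟩
  rw [hrisk φ hφ, hrisk φs hφs] at hlt
  rw [hemp τ hτ, hemp τ hτ] at hle
  have hmean : ∀ v : X × X × X → ℝ, (1 / N : ℝ) * ∑ j, ((∫ x, ℓ v x ∂Q) - ℓ v (τ j)) =
      (∫ x, ℓ v x ∂Q) - (1 / N : ℝ) * ∑ j, ℓ v (τ j) := fun v => by
    rw [Finset.sum_sub_distrib, mul_sub]
    simp only [Finset.sum_const, Finset.card_univ, Fintype.card_fin, nsmul_eq_mul]
    field_simp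
  have hmeans : (1 / N : ℝ) * ∑ j, (ℓ (tripleMap ω φs) (τ j) - ∫ x, ℓ (tripleMap ω φs) x ∂Q) =
      (1 / N : ℝ) * ∑ j, ℓ (tripleMap ω φs) (τ j) - ∫ x, ℓ (tripleMap ω φs) x ∂Q := by
    have := hmean (tripleMap ω φs)
    rw [← neg_inj, ← mul_neg, ← Finset.sum_neg_distrib]
    simpa using this
  set thr := (∫ τ : Fin N → 𝒯, ⨆ i : s, (1 / N : ℝ) * ∑ j, ((∫ x, ℓ i.1.1 x ∂Q) - ℓ i.1.1 (τ j))
      ∂(Measure.pi fun _ => Q)) + 2 * C ^ 2 * √(Real.log (1 / δ) / (2 * N)) with hthr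
  -- Strictly exceeding the threshold is an open condition on the predictor, so a violation by any
  -- encoder in `Φ` forces one in the countable dense subclass.
  have hopen : IsOpen {v : F | thr < (1 / N : ℝ) * ∑ j, ((∫ x, ℓ v x ∂Q) - ℓ v (τ j)) +
      (1 / N : ℝ) * ∑ j, (ℓ (tripleMap ω φs) (τ j) - ∫ x, ℓ (tripleMap ω φs) x ∂Q)} :=
    isOpen_lt continuous_const ((hcont τ).add continuous_const)
  obtain ⟨v, hv, hvs⟩ := hsd.exists_mem_open hopen ⟨⟨_, φ, hφ, rfl⟩, by
    simp only [Set.mem_ofPred_eq]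
    rw [hmean, hmeans]
    unfold statisticalError at hlt
    linarith⟩
  exact ⟨⟨v, hv⟩, hvs⟩

end ExcessRisk

/-! ### Conversions between `L²` norms and integrals of squares -/

lemma eLpNorm_two_sq {α : Type*} [MeasurableSpace α] (f : α → ℝ) (μ : Measure α) :
    eLpNorm f 2 μ ^ 2 = ∫⁻ x, ‖f x‖ₑ ^ 2 ∂μ := by
  have := eLpNorm_nnreal_pow_eq_lintegral (μ := μ) (f := f) (p := 2) two_ne_zero
  simpa using this

lemma enorm_sq_eq_ofReal_sq (x : ℝ) : ‖x‖ₑ ^ 2 = ENNReal.ofReal (x ^ 2) := by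
  rw [Real.enorm_eq_ofReal_abs, ← ENNReal.ofReal_pow (abs_nonneg x), sq_abs]

lemma memLp_label {X : Type u} [MeasurableSpace X] {𝒯 : Type v} [MeasurableSpace 𝒯]
    (Q : Measure 𝒯) [IsFiniteMeasure Q] {m : ℕ}
    {z : Fin m → 𝒯 → DataTuple X}
    (hz : ∀ t, Measurable (z t)) {Hmax : ℝ}
    (hlabel : ∀ t, ∀ᵐ τ ∂Q, 0 ≤ (z t τ).2.2.2 ∧ (z t τ).2.2.2 ≤ Hmax) :
    MemLp (fun y : DataTuple X => y.2.2.2) 2 (tupleLaw Q z) := by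
  refine MemLp.of_bound measurable_label.aestronglyMeasurable Hmax ?_
  have hmeas : MeasurableSet {y : DataTuple X | 0 ≤ y.2.2.2 ∧ y.2.2.2 ≤ Hmax} :=
    (measurableSet_le measurable_const measurable_label).inter
      (measurableSet_le measurable_label measurable_const)
  filter_upwards [ae_tupleLaw hz hmeas hlabel] with y hy
  rw [Real.norm_of_nonneg hy.1]
  exact hy.2

lemma lintegral_enorm_sq_eq_ofReal_integral {α : Type*} [MeasurableSpace α] {μ : Measure α}
    {f : α → ℝ} (hf : MemLp f 2 μ) :
    ∫⁻ x, ‖f x‖ₑ ^ 2 ∂μ = ENNReal.ofReal (∫ x, f x ^ 2 ∂μ) := by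
  rw [ofReal_integral_eq_lintegral_ofReal hf.integrable_sq (.of_forall fun x => sq_nonneg _)]
  simp only [enorm_sq_eq_ofReal_sq]

lemma integral_sq_le_of_eLpNorm_le {α : Type*} [MeasurableSpace α] {μ : Measure α} {f : α → ℝ}
    (hf : MemLp f 2 μ) {a : ℝ} (ha : 0 ≤ a) (h : eLpNorm f 2 μ ≤ ENNReal.ofReal a) :
    ∫ x, f x ^ 2 ∂μ ≤ a ^ 2 := by
  have h2 : ENNReal.ofReal (∫ x, f x ^ 2 ∂μ) ≤ ENNReal.ofReal (a ^ 2) := by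
    rw [← lintegral_enorm_sq_eq_ofReal_integral hf, ← eLpNorm_two_sq, ENNReal.ofReal_pow ha]
    exact pow_le_pow_left' h 2
  exact (ENNReal.ofReal_le_ofReal_iff (sq_nonneg a)).1 h2

/-! ### Distance of a minimizer to the conditional mean -/

section ERM

variable {X : Type u} [MeasurableSpace X] [MeasurableSingletonClass X] [Finite X]
  {𝒯 : Type v} [MeasurableSpace 𝒯] {E : Type w} [NormedAddCommGroup E] [InnerProductSpace ℝ E]

lemma memLp_stateGoal (μ : Measure (DataTuple X)) [IsFiniteMeasure μ] (f : X × X × X → ℝ) :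
    MemLp (fun y : DataTuple X => f (y.1, y.2.1, y.2.2.1)) 2 μ := by
  obtain ⟨M, hM⟩ := (Set.finite_range fun x => |f x|).bddAbove
  exact MemLp.of_bound ((measurable_of_finite f).comp measurable_stateGoal).aestronglyMeasurable M
    (.of_forall fun y => hM ⟨_, rfl⟩)

/-- With high probability, every empirical risk minimizer is close in `L²` to the conditional mean
of the label, up to the approximation error of the class and the statistical error. -/
lemma measure_pi_minimizer_error_gt_le (Q : Measure 𝒯) [IsProbabilityMeasure Q] {N : ℕ}
    (hN : 0 < N) {m : ℕ} (hm : 0 < m) {z : Fin m → 𝒯 → DataTuple X} (hz : ∀ t, Measurable (z t))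
    {ω : X → E} {Φ : Set (X → E)} {Cφ Cω Hmax : ℝ} (hCφ : ∀ φ ∈ Φ, ∀ x, ‖φ x‖ ≤ Cφ)
    (hCω : ∀ g, ‖ω g‖ ≤ Cω)
    (hlabel : ∀ t, ∀ᵐ τ ∂Q, 0 ≤ (z t τ).2.2.2 ∧ (z t τ).2.2.2 ≤ Hmax)
    {δ : ℝ} (hδ : 0 < δ) (hδ1 : δ < 1) {β : ℝ} (hβ : 0 ≤ β)
    (happrox : ∀ c > 0, ∃ φ ∈ Φ, ∫ y, (predictor ω φ y.1 y.2.1 y.2.2.1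
      - labelMean (tupleLaw Q z) y) ^ 2 ∂(tupleLaw Q z) ≤ (β + c) ^ 2) :
    (Measure.pi fun _ : Fin N => Q) {τ | ∃ φ ∈ Φ,
      (∀ φ' ∈ Φ, empiricalRisk z ω τ φ ≤ empiricalRisk z ω τ φ') ∧
      β ^ 2 + statisticalError Q N z ω Φ Cφ Cω Hmax δ <
        ∫ y, (predictor ω φ y.1 y.2.1 y.2.2.1 - labelMean (tupleLaw Q z) y) ^ 2
          ∂(tupleLaw Q z)} ≤ ENNReal.ofReal δ := by
  set μ := tupleLaw Q z
  set Γ := statisticalError Q N z ω Φ Cφ Cω Hmax δ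
  set L : (X → E) → ℝ := fun φ =>
    ∫ y, (predictor ω φ y.1 y.2.1 y.2.2.1 - labelMean μ y) ^ 2 ∂μ with hL
  have hdecomp : ∀ φ, ∫ y, (predictor ω φ y.1 y.2.1 y.2.2.1 - y.2.2.2) ^ 2 ∂μ =
      L φ + ∫ y, (labelMean μ y - y.2.2.2) ^ 2 ∂μ := fun φ =>
    integral_sq_sub_label μ (memLp_label Q hz hlabel) (measurable_of_finite (tripleMap ω φ))
      (memLp_stateGoal μ _)
  set c : ℕ → ℝ := fun n => 1 / ((n : ℝ) + 1) with hc
  -- The approximation infimum need not be attained, so each slack `c n` has its own competitor.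
  -- These failure events increase to cover the limiting one, and continuity from below keeps the
  -- bound `δ`.
  set S : ℕ → Set (Fin N → 𝒯) := fun n => {τ | ∃ φ ∈ Φ,
    (∀ φ' ∈ Φ, empiricalRisk z ω τ φ ≤ empiricalRisk z ω τ φ') ∧
      (β + c n) ^ 2 + Γ < L φ} with hS
  have hSmono : Monotone S := by
    rintro n k hnk τ ⟨φ, hφ, hmin, hlt⟩
    refine ⟨φ, hφ, hmin, lt_of_le_of_lt ?_ hlt⟩
    have h1 : c k ≤ c n := Nat.one_div_le_one_div hnk
    have h2 : 0 < c k := Nat.one_div_pos_of_nat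
    gcongr
  have hSle : ∀ n, (Measure.pi fun _ : Fin N => Q) (S n) ≤ ENNReal.ofReal δ := by
    intro n
    obtain ⟨φs, hφs, happ⟩ := happrox (c n) Nat.one_div_pos_of_nat
    refine (measure_mono ?_).trans
      (measure_pi_excess_risk_gt_le Q hN hm hz hCφ hCω hlabel hδ hδ1 hφs)
    rintro τ ⟨φ, hφ, hmin, hlt⟩
    refine ⟨φ, hφ, hmin φs hφs, ?_⟩
    change (∫ y, (predictor ω φs y.1 y.2.1 y.2.2.1 - y.2.2.2) ^ 2 ∂μ) + Γ <
      ∫ y, (predictor ω φ y.1 y.2.1 y.2.2.1 - y.2.2.2) ^ 2 ∂μ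
    rw [hdecomp φs, hdecomp φ]
    have : L φs ≤ (β + c n) ^ 2 := happ
    linarith
  have hunion : {τ | ∃ φ ∈ Φ, (∀ φ' ∈ Φ, empiricalRisk z ω τ φ ≤ empiricalRisk z ω τ φ') ∧
      β ^ 2 + Γ < L φ} ⊆ ⋃ n, S n := by
    rintro τ ⟨φ, hφ, hmin, hlt⟩
    have htend : Filter.Tendsto (fun n => (β + c n) ^ 2 + Γ) Filter.atTop
        (nhds ((β + 0) ^ 2 + Γ)) :=
      ((tendsto_one_div_add_atTop_nhds_zero_nat.const_add β).pow 2).add_const Γ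
    rw [add_zero] at htend
    obtain ⟨n, hn⟩ := (htend.eventually_lt_const hlt).exists
    exact Set.mem_iUnion.2 ⟨n, φ, hφ, hmin, hn⟩
  refine (measure_mono hunion).trans ?_
  rw [hSmono.measure_iUnion]
  exact iSup_le hSle

end ERM

/-! ### Goal coverage and the three-term splitting -/

section Alignment

variable {X : Type u} [MeasurableSpace X] [MeasurableSingletonClass X] [Finite X]

/-- Goal coverage transfers an `L²(ν)` bound for almost every pair to an `L²` bound under the law
of the tuples. -/
lemma lintegral_pairLaw_le_of_coverage [StandardBorelSpace X] [Nonempty X]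
    (μ : Measure (DataTuple X)) [IsFiniteMeasure μ] (ν : Measure X) {c : ℝ≥0∞}
    (hcov : ∀ᵐ p ∂(pairLaw μ), c • ν ≤ goalLaw μ p) (F : X → X → X → ℝ≥0∞) :
    c * ∫⁻ p, ∫⁻ g, F p.1 p.2 g ∂ν ∂(pairLaw μ) ≤ ∫⁻ y, F y.1 y.2.1 y.2.2.1 ∂μ := by
  have hpair : Measurable fun y : DataTuple X => (y.1, y.2.1) :=
    measurable_fst.prodMk (measurable_fst.comp measurable_snd)
  have hgoal : Measurable fun y : DataTuple X => y.2.2.1 :=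
    measurable_fst.comp (measurable_snd.comp measurable_snd)
  have hF : Measurable fun q : (X × X) × X => F q.1.1 q.1.2 q.2 := measurable_of_finite _
  have hdis : ∫⁻ y, F y.1 y.2.1 y.2.2.1 ∂μ =
      ∫⁻ p, ∫⁻ g, F p.1 p.2 g ∂(goalLaw μ p) ∂(pairLaw μ) := by
    have h : pairLaw μ ⊗ₘ goalLaw μ = μ.map (fun y => ((y.1, y.2.1), y.2.2.1)) :=
      compProd_map_condDistrib hgoal.aemeasurable
    rw [← lintegral_map hF (hpair.prodMk hgoal), ← h]
    unfold goalLaw pairLaw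
    exact Measure.lintegral_compProd hF
  rw [hdis, ← lintegral_const_mul _ (measurable_of_finite _)]
  refine lintegral_mono_ae ?_
  filter_upwards [hcov] with p hp
  rw [← smul_eq_mul, ← lintegral_smul_measure]
  exact lintegral_mono' hp le_rfl

/-- Two uses of `(a + b)² ≤ 2a² + 2b²`, separating `G - k` first: it is charged `2`, the other two
pieces `4`. -/
lemma lintegral_enorm_sq_le_of_decomposition {α : Type*} [MeasurableSpace α] {μ : Measure α}
    {f m G k : α → ℝ} (hf : Measurable f) (hm : Measurable m) (hG : Measurable G) :
    ∫⁻ y, ‖f y - k y‖ₑ ^ 2 ∂μ ≤ 4 * ∫⁻ y, ‖f y - m y‖ₑ ^ 2 ∂μ +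
      4 * ∫⁻ y, ‖m y - G y‖ₑ ^ 2 ∂μ + 2 * ∫⁻ y, ‖G y - k y‖ₑ ^ 2 ∂μ := by
  have h1 : Measurable fun y => ‖f y - m y‖ₑ ^ 2 := (hf.sub hm).enorm.pow_const 2
  have h2 : Measurable fun y => ‖m y - G y‖ₑ ^ 2 := (hm.sub hG).enorm.pow_const 2
  have h3 : Measurable fun y => 4 * ‖f y - m y‖ₑ ^ 2 + 4 * ‖m y - G y‖ₑ ^ 2 :=
    (h1.const_mul 4).add (h2.const_mul 4)
  rw [← lintegral_const_mul _ h1, ← lintegral_const_mul _ h2,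
    ← lintegral_const_mul' _ _ ENNReal.ofNat_ne_top, ← lintegral_add_left (h1.const_mul 4),
    ← lintegral_add_left h3]
  refine lintegral_mono fun y => ?_
  simp only [enorm_sq_eq_ofReal_sq]
  rw [← ENNReal.ofReal_ofNat 4, ← ENNReal.ofReal_ofNat 2, ← ENNReal.ofReal_mul (by norm_num),
    ← ENNReal.ofReal_mul (by norm_num), ← ENNReal.ofReal_mul (by norm_num),
    ← ENNReal.ofReal_add (by positivity) (by positivity),
    ← ENNReal.ofReal_add (by positivity) (by positivity)]
  refine ENNReal.ofReal_le_ofReal ?_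
  nlinarith [sq_nonneg (f y - m y - (m y - G y)),
    sq_nonneg (f y - m y + (m y - G y) - (G y - k y))]

end Alignment

end HittingGeometry

/-! ### Assembly of the alignment bound -/

theorem theorem3p5
    {X : Type u} [TopologicalSpace X] [TopologicalSpace.MetrizableSpace X]
    [SecondCountableTopology X] [MeasurableSpace X] [BorelSpace X] [StandardBorelSpace X]
    [Nonempty X] {A : Type v} [MeasurableSpace A]
    (P : Kernel (X × A) X) [IsMarkovKernel P] (πB : Kernel X A) [IsMarkovKernel πB]
    (x₀ : X) (ν : Measure X) [IsProbabilityMeasure ν] [ν.IsOpenPosMeasure]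
    (ε : ℝ) (hε : 0 ≤ ε) (ηstar : ℝ)
    (hηstar : ηstar = oracleScale.{u, w} (policyKernel P πB) ε x₀ ν)
    {E : Type w₁} [NormedAddCommGroup E] [InnerProductSpace ℝ E] [CompleteSpace E]
    (Φ : Set (X → E)) (hΦmeas : ∀ φ ∈ Φ, StronglyMeasurable φ)
    (ωψ : X → E) (hωmeas : StronglyMeasurable ωψ)
    (Cφ Cω Hmax : ℝ) (hCφ : ∀ φ ∈ Φ, ∀ x, ‖φ x‖ ≤ Cφ) (hCω : ∀ g, ‖ωψ g‖ ≤ Cω)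
    (ρ₀ : Measure X) [IsProbabilityMeasure ρ₀]
    (Q : Measure (Trajectory X A)) [IsProbabilityMeasure Q] (hQ : IsTrajectoryLaw P πB ρ₀ Q)
    {Ω : Type w₂} [MeasurableSpace Ω] (prob : Measure Ω) [IsProbabilityMeasure prob]
    (N : ℕ) (hN : 0 < N) (τ : Fin N → Ω → Trajectory X A) (hτmeas : ∀ j, Measurable (τ j))
    (hτindep : iIndepFun τ prob) (hτlaw : ∀ j, prob.map (τ j) = Q)
    (mtr : ℕ) (hmtr : 0 < mtr) (z : Fin mtr → Trajectory X A → DataTuple X)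
    (hzmeas : ∀ t, Measurable (z t))
    (hlabel : ∀ t, ∀ᵐ τ' ∂Q, 0 ≤ (z t τ').2.2.2 ∧ (z t τ').2.2.2 ≤ Hmax)
    (φhat : Ω → X → E)
    (hφhat : ∀ᵐ ω' ∂prob, φhat ω' ∈ Φ ∧
      ∀ φ ∈ Φ, empiricalRisk z ωψ (fun j => τ j ω') (φhat ω') ≤
        empiricalRisk z ωψ (fun j => τ j ω') φ)
    (ccov : ℝ) (hccov : 0 < ccov) (hccov_le : ccov ≤ 1)
    (hcov : ∀ᵐ p ∂(pairLaw (tupleLaw Q z)),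
      ENNReal.ofReal ccov • ν ≤ goalLaw (tupleLaw Q z) p)
    (hA : ∀ᵐ ω' ∂prob, AnalysisBounded ν (learnedSpace (pairLaw (tupleLaw Q z)) (φhat ω')) ωψ)
    (ηcls : ℝ) (hηcls : 0 ≤ 2 * ηstar + ηcls)
    (hcomp : (⨅ φ ∈ Φ, eLpNorm (fun y : DataTuple X =>
        predictor ωψ φ y.1 y.2.1 y.2.2.1 - displacementTarget P πB y.1 y.2.1 y.2.2.1)
        2 (tupleLaw Q z)) ≤ ENNReal.ofReal (2 * ηstar + ηcls))
    (ηtraj : ℝ) (hηtraj : 0 ≤ ηtraj)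
    (hcompat : eLpNorm (fun y : DataTuple X =>
        labelMean (tupleLaw Q z) y - displacementTarget P πB y.1 y.2.1 y.2.2.1)
        2 (tupleLaw Q z) ≤ ENNReal.ofReal ηtraj)
    (δ : ℝ) (hδ : 0 < δ) (hδ1 : δ < 1) (δor : ℝ) (hδor : 0 < δor)
    (r : Reference.{u, w} X) (hr : r.Admissible (policyKernel P πB) ε x₀ ν)
    (hrδ : r.benchmark ε ≤ ηstar + δor)
    (mB : ℝ) (hmB : 0 < mB) (hB : AnalysisLowerBound ν (r.displacementSpace x₀) r.ω mB) :
    prob {ω' | ¬ ∃ T : learnedSpace (pairLaw (tupleLaw Q z)) (φhat ω') →L[ℝ] r.displacementSpace x₀,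
        (∫⁻ p, ‖((applyOn T (φhat ω' p.2 - φhat ω' p.1) : r.displacementSpace x₀) : r.H)
            - (r.φ p.2 - r.φ p.1)‖ₑ ^ 2 ∂(pairLaw (tupleLaw Q z))) ≤
          ENNReal.ofReal (4 / (ccov * mB ^ 2) *
            ((2 * ηstar + ηcls + ηtraj) ^ 2
              + statisticalError Q N z ωψ Φ Cφ Cω Hmax δ
              + ηtraj ^ 2
              + 2 * (ηstar + δor) ^ 2))} ≤ ENNReal.ofReal δ := by
  have hfin : Finite X := hr.finite
  have hμ : IsProbabilityMeasure (tupleLaw Q z) := isProbabilityMeasure_tupleLaw Q hmtr hzmeas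
  set μ := tupleLaw Q z with hμdef
  set G : X × X × X → ℝ := fun x => displacementTarget P πB x.1 x.2.1 x.2.2 with hG
  set Γ := statisticalError Q N z ωψ Φ Cφ Cω Hmax δ with hΓ
  have hproj := measurable_stateGoal (X := X)
  have hLmem : MemLp (labelMean μ) 2 μ :=
    (memLp_label Q hzmeas hlabel).condExp (by norm_num)
  have hLmeas : Measurable (labelMean μ) :=
    (stronglyMeasurable_condExp.mono hproj.comap_le).measurable
  have hGmem := memLp_stateGoal μ G
  have hfmem : ∀ φ : X → E, MemLp (fun y : DataTuple X => predictor ωψ φ y.1 y.2.1 y.2.2.1) 2 μ :=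
    fun φ => memLp_stateGoal μ (tripleMap ωψ φ)
  set β := 2 * ηstar + ηcls + ηtraj with hβdef
  have hβ : 0 ≤ β := by linarith
  have happrox : ∀ c > 0, ∃ φ ∈ Φ, ∫ y, (predictor ωψ φ y.1 y.2.1 y.2.2.1
      - labelMean μ y) ^ 2 ∂μ ≤ (β + c) ^ 2 := by
    intro c hc
    have hlt := hcomp.trans_lt
      ((ENNReal.ofReal_lt_ofReal_iff (by linarith : 0 < 2 * ηstar + ηcls + c)).2
        (lt_add_of_pos_right _ hc))
    simp only [iInf_lt_iff] at hlt
    obtain ⟨φ, hφ, hlt⟩ := hlt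
    refine ⟨φ, hφ, integral_sq_le_of_eLpNorm_le ((hfmem φ).sub hLmem) (by linarith) ?_⟩
    -- Class error and label bias add through `G`, which gives `β` its three summands.
    have hsplit : (fun y : DataTuple X => predictor ωψ φ y.1 y.2.1 y.2.2.1) - labelMean μ =
        ((fun y : DataTuple X => predictor ωψ φ y.1 y.2.1 y.2.2.1) -
          fun y => G (y.1, y.2.1, y.2.2.1)) +
        ((fun y => G (y.1, y.2.1, y.2.2.1)) - labelMean μ) := by
      rw [sub_add_sub_cancel]
    change eLpNorm ((fun y : DataTuple X => predictor ωψ φ y.1 y.2.1 y.2.2.1) - labelMean μ) 2 μ ≤ _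
    rw [hsplit]
    refine (eLpNorm_add_le ((hfmem φ).sub hGmem).1 (hGmem.sub hLmem).1 (by norm_num)).trans ?_
    rw [eLpNorm_sub_comm (fun y : DataTuple X => G (y.1, y.2.1, y.2.2.1)) (labelMean μ)]
    refine (add_le_add hlt.le hcompat).trans_eq ?_
    rw [← ENNReal.ofReal_add (by linarith) hηtraj]
    congr 1
    rw [hβdef]
    ring
  have hest := measure_pi_minimizer_error_gt_le Q hN hmtr hzmeas hCφ hCω hlabel hδ hδ1 hβ happrox
  have hmap : prob.map (fun ω' j => τ j ω') = Measure.pi fun _ => Q := by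
    rw [(iIndepFun_iff_map_fun_eq_pi_map fun j => (hτmeas j).aemeasurable).1 hτindep]
    simp only [hτlaw]
  rw [← hmap] at hest
  -- The failure event is not known to be measurable; this inequality for the image measure holds
  -- for arbitrary sets.
  refine (measure_mono_ae ?_).trans ((Measure.le_map_apply
    (measurable_pi_lambda _ hτmeas).aemeasurable _).trans hest)
  filter_upwards [hφhat, hA] with ω' hmin hbdd hbad
  set φ := φhat ω'
  by_contra hnot
  have herr : ∫ y, (predictor ωψ φ y.1 y.2.1 y.2.2.1 - labelMean μ y) ^ 2 ∂μ ≤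
      β ^ 2 + Γ := by
    by_contra hlt
    exact hnot ⟨φ, hmin.1, hmin.2, not_le.1 hlt⟩
  obtain ⟨T, hT⟩ := exists_alignment hbdd hr.analysis_bounded hmB hB
  refine hbad ⟨T, ?_⟩
  have hdisp : ∀ x, r.φ x - r.φ x₀ ∈ r.displacementSpace x₀ := fun x =>
    Submodule.le_topologicalClosure _ (Submodule.subset_span ⟨x, rfl⟩)
  have hdisp2 : ∀ s u, r.φ u - r.φ s ∈ r.displacementSpace x₀ := fun s u => by
    have := Submodule.sub_mem _ (hdisp u) (hdisp s)
    rwa [sub_sub_sub_cancel_right] at this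
  have hpoint : ∀ᵐ p ∂(pairLaw μ), ENNReal.ofReal (mB ^ 2) *
      ‖((applyOn T (φ p.2 - φ p.1) : r.displacementSpace x₀) : r.H) - (r.φ p.2 - r.φ p.1)‖ₑ ^ 2 ≤
      ∫⁻ g, ‖predictor ωψ φ p.1 p.2 g - predictor r.ω r.φ p.1 p.2 g‖ₑ ^ 2 ∂ν := by
    -- Almost every pair lies in the support, so the learned displacement belongs to the domain of
    -- `T` and `applyOn` does not take its default value.
    filter_upwards [Measure.support_mem_ae (μ := pairLaw μ)] with p hp
    have hmem : φ p.2 - φ p.1 ∈ learnedSpace (pairLaw μ) φ :=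
      Submodule.le_topologicalClosure _ (Submodule.subset_span ⟨p, hp, rfl⟩)
    have h := pow_le_pow_left' (hT ⟨_, hmem⟩ ⟨_, hdisp2 p.1 p.2⟩) 2
    rw [eLpNorm_two_sq] at h
    refine le_of_eq_of_le ?_ h
    rw [applyOn, dif_pos hmem, ENNReal.ofReal_mul hmB.le, mul_pow, ENNReal.ofReal_pow hmB.le,
      ofReal_norm]
    rfl
  set I := ∫⁻ p, ‖((applyOn T (φ p.2 - φ p.1) : r.displacementSpace x₀) : r.H)
    - (r.φ p.2 - r.φ p.1)‖ₑ ^ 2 ∂(pairLaw μ) with hI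
  have hK : 0 < ccov * mB ^ 2 := by positivity
  have hstep : ENNReal.ofReal (ccov * mB ^ 2) * I ≤
      ∫⁻ y : DataTuple X, ‖predictor ωψ φ y.1 y.2.1 y.2.2.1
        - predictor r.ω r.φ y.1 y.2.1 y.2.2.1‖ₑ ^ 2 ∂μ := by
    refine le_trans ?_ (lintegral_pairLaw_le_of_coverage μ ν hcov fun s u g =>
      ‖predictor ωψ φ s u g - predictor r.ω r.φ s u g‖ₑ ^ 2)
    rw [ENNReal.ofReal_mul hccov.le, mul_assoc, hI,
      ← lintegral_const_mul' _ _ ENNReal.ofReal_ne_top]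
    gcongr ENNReal.ofReal ccov * ?_
    exact lintegral_mono_ae hpoint
  have hb := fun s u g => (hr.abs_predictor_sub_displacementTarget_le hε s u g).trans
    (mul_le_mul_of_nonneg_left hrδ zero_le_two)
  have href : ∫⁻ y : DataTuple X, ‖G (y.1, y.2.1, y.2.2.1)
      - predictor r.ω r.φ y.1 y.2.1 y.2.2.1‖ₑ ^ 2 ∂μ ≤
        ENNReal.ofReal ((2 * (ηstar + δor)) ^ 2) := by
    calc _ ≤ ∫⁻ _ : DataTuple X, ENNReal.ofReal ((2 * (ηstar + δor)) ^ 2) ∂μ := by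
          refine lintegral_mono fun y => ?_
          rw [enorm_sq_eq_ofReal_sq]
          exact ENNReal.ofReal_le_ofReal
            (sq_le_sq.2 ((hb y.1 y.2.1 y.2.2.1).trans (le_abs_self _)))
      _ = _ := by simp
  have htraj : ∫⁻ y : DataTuple X, ‖labelMean μ y - G (y.1, y.2.1, y.2.2.1)‖ₑ ^ 2 ∂μ ≤
      ENNReal.ofReal (ηtraj ^ 2) := by
    rw [← eLpNorm_two_sq, ENNReal.ofReal_pow hηtraj]
    exact pow_le_pow_left' hcompat 2
  have hfit : ∫⁻ y : DataTuple X, ‖predictor ωψ φ y.1 y.2.1 y.2.2.1 - labelMean μ y‖ₑ ^ 2 ∂μ ≤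
      ENNReal.ofReal (β ^ 2 + Γ) :=
    (lintegral_enorm_sq_eq_ofReal_integral ((hfmem φ).sub hLmem)).trans_le
      (ENNReal.ofReal_le_ofReal herr)
  -- Nonnegativity is read off from the squared error it dominates, without determining the sign of
  -- `Γ`; it allows the `ENNReal.ofReal` terms to be merged.
  have hnonneg : 0 ≤ β ^ 2 + Γ := (integral_nonneg fun y => sq_nonneg _).trans herr
  have htotal := (hstep.trans (lintegral_enorm_sq_le_of_decomposition (m := labelMean μ)
    (G := fun y => G (y.1, y.2.1, y.2.2.1))
    ((measurable_of_finite (tripleMap ωψ φ)).comp hproj) hLmeas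
    ((measurable_of_finite G).comp hproj))).trans
    (add_le_add (add_le_add (mul_le_mul_right hfit 4) (mul_le_mul_right htraj 4))
      (mul_le_mul_right href 2))
  rw [← ENNReal.ofReal_ofNat 4, ← ENNReal.ofReal_ofNat 2, ← ENNReal.ofReal_mul (by norm_num),
    ← ENNReal.ofReal_mul (by norm_num), ← ENNReal.ofReal_mul (by norm_num),
    ← ENNReal.ofReal_add (by positivity) (by positivity),
    ← ENNReal.ofReal_add (by positivity) (by positivity), mul_comm,
    ← ENNReal.le_div_iff_mul_le (Or.inl (by simpa using hK)) (Or.inl ENNReal.ofReal_ne_top),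
    ← ENNReal.ofReal_div_of_pos hK] at htotal
  -- The reference term is `2 * (2 * (ηstar + δor)) ^ 2 = 4 * (2 * (ηstar + δor) ^ 2)`, so `4`
  -- factors out of the whole sum.
  refine htotal.trans_eq (congrArg _ ?_)
  field_simp
  ring
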